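/- Let $M=(\mathcal S,\mathcal A,P,R,H,\mu)$ be an $H$-horizon Markov decision process, $H\ge 1$, with finite non-empty state space $\mathcal S$ and action space $\mathcal A$, transition laws $P(s,a)$ on $\mathcal S$, reward laws $R(s,a)$ on $\mathbb R$ and initial state distribution $\mu$. A policy is $\pi=(\pi_0,\dots,\pi_{H-1})$ with $\pi_h:\mathcal S\to\mathcal A$. It induces a random trajectory $s_0\sim\mu$, $a_h=\pi_h(s_h)$, $r_h\sim R(s_h,a_h)$, $s_{h+1}\sim P(s_h,a_h)$ ($0\le h<H$); its value is $V^\pi_{M}=\mathbb E\big[\sum_{h=0}^{H-1}r_h\big]$, and $V^*_M=\max_\pi V^\pi_M$. Assume that the total reward is bounded: for every policy $\pi$, almost surely $r_h\in[0,1]$ for all $h$ and $\sum_{h=0}^{H-1}r_h\le 1$. Let $0<\epsilon\le 1$, $0<\delta<1$ and $$N \;=\; H\cdot\Big\lfloor \frac{2^{29}\,|\mathcal S|^5\,|\mathcal A|^3\,\log(2/\delta)}{\epsilon^3}\Big\rfloor .$$ Consider the algorithm that queries a generative model $N$ times for each $(s,a)\in\mathcal S\times\mathcal A$, each query returning a next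 state $s'\sim P(s,a)$ and a reward $r\sim R(s,a)$, and $N$ times for an initial state $s\sim\mu$, all draws being independent. From these it forms the empirical transition frequencies $\widehat P$, the empirical mean rewards $\widehat R$ and the empirical initial state frequencies $\widehat\mu$, and it returns a (non-stationary) policy maximizing $\pi\mapsto V^\pi_{\widehat M}$, where $\widehat M=(\mathcal S,\mathcal A,\widehat P,\widehat R,H,\widehat\mu)$. Then $N\geq 1$, and with probability at least $1-\delta$ every policy $\pi$ that maximizes $V^\pi_{\widehat M}$ (hence the returned one, however ties are broken) satisfies $$V^\pi_M\;\ge\;V^*_M-\epsilon .$$ The number of batches of $H$ queries used is at most $2^{30}\,|\mathcal S|^6\,|\mathcal A|^4\,\log(2/\delta)/\epsilon^3$. -/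

import Mathlib

open MeasureTheory

open scoped ENNReal

noncomputable section

/-- A finite-horizon Markov decision process with state space `S`, action space `A` and planning
horizon `H`: transition operator, reward distributions and initial state distribution. -/
structure MDP (S A : Type*) (H : ℕ) where
  /-- `trans s a` is the law of the next state after taking action `a` in state `s`. -/
  trans : S → A → PMF S
  /-- `reward s a` is the law of the reward collected when taking action `a` in state `s`. -/
  reward : S → A → ProbabilityMeasure ℝ
  /-- The law of the initial state. -/
  init : PMF S

/-- Deterministic, possibly non-stationary policies `π = (π_0, …, π_{H-1})`. -/
abbrev Policy (S A : Type*) (H : ℕ) : Type _ := Fin H → S → A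

/-- A trajectory, recorded as its states `s_0, …, s_H` and its rewards `r_0, …, r_{H-1}`.
The actions `a_h = π_h(s_h)` are determined by the policy. -/
abbrev Traj (S : Type*) (H : ℕ) : Type _ := (Fin (H + 1) → S) × (Fin H → ℝ)

namespace MDP

variable {S A : Type*} {H : ℕ}

/-- Probability that the state sequence is `σ` when executing `π`:
`μ(s_0) ∏_{h < H} P(s_{h+1} | s_h, π_h(s_h))`. -/
def stateSeqProb (M : MDP S A H) (π : Policy S A H) (σ : Fin (H + 1) → S) : ℝ≥0∞ :=
  M.init (σ 0) * ∏ h : Fin H, M.trans (σ h.castSucc) (π h (σ h.castSucc)) (σ h.succ)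

/-- Law of the random trajectory induced by `π`: given the states, the rewards are independent
with `r_h ∼ R(s_h, π_h(s_h))`. -/
def trajLaw [Fintype S] [MeasurableSpace S] (M : MDP S A H) (π : Policy S A H) :
    Measure (Traj S H) :=
  ∑ σ : Fin (H + 1) → S, M.stateSeqProb π σ •
    (Measure.dirac σ).prod
      (Measure.pi fun h : Fin H =>
        (M.reward (σ h.castSucc) (π h (σ h.castSucc)) : Measure ℝ))

/-- The value of a policy: the expected total reward of its trajectory. -/
def value [Fintype S] [MeasurableSpace S] (M : MDP S A H) (π : Policy S A H) : ℝ :=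
  ∫ τ, ∑ h : Fin H, τ.2 h ∂(M.trajLaw π)

/-- The optimal value, over all non-stationary deterministic policies. -/
def optValue [Fintype S] [MeasurableSpace S] (M : MDP S A H) : ℝ :=
  ⨆ π : Policy S A H, M.value π

/-- `π` attains the maximum of the value over all policies. -/
def IsOptimal [Fintype S] [MeasurableSpace S] (M : MDP S A H) (π : Policy S A H) : Prop :=
  ∀ π' : Policy S A H, M.value π' ≤ M.value π

/-- Bounded total reward: under every policy, almost surely all rewards of the trajectory lie in
`[0, 1]` and their sum is at most `1`. -/
def BoundedTotalReward [Fintype S] [MeasurableSpace S] (M : MDP S A H) : Prop :=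
  ∀ π : Policy S A H, ∀ᵐ τ ∂(M.trajLaw π),
    (∀ h : Fin H, τ.2 h ∈ Set.Icc (0 : ℝ) 1) ∧ ∑ h : Fin H, τ.2 h ≤ 1

end MDP

/-- The answers to the queries of the algorithm that asks the generative model `N` times for each
state-action pair and `N` times for an initial state. A query at `(s, a)` is answered by a next
state and a reward, an initial-state query by a state. -/
abbrev GenSample (S A : Type*) (N : ℕ) : Type _ := (S × A × Fin N → S × ℝ) × (Fin N → S)

/-- Number of queries behind a `GenSample`: one for each recorded answer. -/
def numQueries (S A : Type*) [Fintype S] [Fintype A] (N : ℕ) : ℕ :=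
  Fintype.card (S × A × Fin N) + Fintype.card (Fin N)

/-- Number of batches, a batch consisting of `H` queries. -/
def numBatches (S A : Type*) [Fintype S] [Fintype A] (H N : ℕ) : ℕ :=
  ⌈(numQueries S A N : ℝ) / (H : ℝ)⌉₊

/-- Law of the answers of the generative model: all independent, `s' ∼ P(s, a)` and `r ∼ R(s, a)`
(independently) for a query at `(s, a)`, and `s ∼ μ` for an initial-state query. -/
def MDP.genLaw {S A : Type*} {H : ℕ} [Fintype S] [Fintype A] [MeasurableSpace S]
    (M : MDP S A H) (N : ℕ) : Measure (GenSample S A N) :=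
  (Measure.pi fun i : S × A × Fin N =>
      (M.trans i.1 i.2.1).toMeasure.prod (M.reward i.1 i.2.1 : Measure ℝ)).prod
    (Measure.pi fun _ : Fin N => M.init.toMeasure)

/-- The empirical distribution of `x_0, …, x_{N-1}`. -/
def empiricalPMF {X : Type*} {N : ℕ} [NeZero N] (x : Fin N → X) : PMF X :=
  (PMF.uniformOfFintype (Fin N)).map x

/-- The empirical model: empirical transition frequencies, empirical mean rewards (received
deterministically) and empirical initial state frequencies. -/
def empiricalMDP {S A : Type*} (H : ℕ) {N : ℕ} [NeZero N] (ω : GenSample S A N) : MDP S A H where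
  trans s a := empiricalPMF fun i => (ω.1 (s, a, i)).1
  reward s a := ⟨Measure.dirac ((∑ i : Fin N, (ω.1 (s, a, i)).2) / (N : ℝ)), inferInstance⟩
  init := empiricalPMF ω.2

end

/-!
The sample size is large enough for *every* policy to be evaluated on the empirical model up to
`ε / 2`, so a policy that is optimal for the empirical model is `ε`-optimal. What has to be
explained is why `N = H K` samples per state-action pair suffice with `K` independent of `H`.

With `L = 7 |S|² |A| log (2 / δ)`, Chernoff's bound gives `|p̂ - p| ≤ 2 √(τ p) + 2 τ` with
`τ = L / N`, simultaneously for all transition probabilities, initial probabilities and mean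
rewards (`MDP.genLaw_not_sampleAccurate_le`; rewards of pairs that no policy reaches are left out,
since nothing is assumed about them). The bound concerns entries only, so it covers all policies
and all time-dependent value functions at once.

Fix a policy and let `V'` be its value function on the empirical model. By the simulation identity
the error of its value is the sum, along a trajectory of the true model, of the one-step errors
`(P̂ - P) V'` and of the reward errors, plus an error due to the initial law. The
arithmetic-geometric mean inequality turns the entrywise bounds into
`|(P̂ - P) V'| ≤ η Var_P V' + |S| τ (1 / η + 2)` (`abs_sum_sub_mul_le_variance`). The second part
adds up to `|S| H τ (1 / η + 2)`, where `H τ = L / K` is free of the horizon. For the first part,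
a law of total variance bounds the sum `T` of the variances along a trajectory by `2 + 2 E`, with
`E` the sum of the absolute one-step errors; as `E ≤ η T + |S| H τ (1 / η + 2)`, this closes up to
`T ≤ 5` (`abs_value_sub_value_le`).

The argument needs `0 ≤ V' ≤ 1` at the states reached by the true model. Given its states the
rewards of a trajectory are independent, so the almost sure bound on their sum is a bound on the
sum of their essential suprema (`MDP.BoundedTotalReward.sum_supReward_le_one`). Empirical mean
rewards lie below the essential suprema and empirical transitions are possible transitions, almost
surely; hence the total empirical reward is at most `1` along every path of the empirical model
(`rewardToGo_mem_Icc_of_isPath`).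
-/

/-! ### Time-inhomogeneous finite Markov reward chains -/

section Chain

variable {S : Type*}

/-- `σ` is a path of positive probability, as far as times `0, …, n` are concerned. -/
def IsPathUpTo (μ : S → ℝ) (P : ℕ → S → S → ℝ) (n : ℕ) (σ : ℕ → S) : Prop :=
  0 < μ (σ 0) ∧ ∀ k < n, 0 < P k (σ k) (σ (k + 1))

lemma IsPathUpTo.update {μ : S → ℝ} {P : ℕ → S → S → ℝ} {h : ℕ} {σ : ℕ → S}
    (hσ : IsPathUpTo μ P h σ) {s : S} (hs : 0 < P h (σ h) s) :
    IsPathUpTo μ P (h + 1) (Function.update σ (h + 1) s) := by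
  refine ⟨by simpa using hσ.1, fun k hk => ?_⟩
  rcases Nat.lt_succ_iff_lt_or_eq.1 hk with hk' | rfl
  · rw [Function.update_of_ne (by omega), Function.update_of_ne (by omega)]
    exact hσ.2 k hk'
  · rw [Function.update_of_ne (by omega), Function.update_self]
    exact hs

variable [Fintype S]

/-- Occupancy measures of the inhomogeneous Markov chain with initial law `μ` and transition
matrices `P h`: `occ μ P h s` is the probability of being in `s` at time `h`. -/
def occ (μ : S → ℝ) (P : ℕ → S → S → ℝ) : ℕ → S → ℝ
  | 0 => μ
  | h + 1 => fun s' => ∑ s, occ μ P h s * P h s s'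

/-- Expected reward collected from time `h` on, during `n` further steps, starting from `s`. -/
def rewardToGo (P : ℕ → S → S → ℝ) (r : ℕ → S → ℝ) : ℕ → ℕ → S → ℝ
  | 0, _ => fun _ => 0
  | n + 1, h => fun s => r h s + ∑ s', P h s s' * rewardToGo P r n (h + 1) s'

lemma rewardToGo_bellman (P : ℕ → S → S → ℝ) (r : ℕ → S → ℝ) {H h : ℕ} (hh : h < H) (s : S) :
    rewardToGo P r (H - h) h s =
      r h s + ∑ s', P h s s' * rewardToGo P r (H - (h + 1)) (h + 1) s' := by
  obtain ⟨n, rfl⟩ := Nat.exists_eq_add_of_lt hh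
  have h1 : h + n + 1 - h = n + 1 := by omega
  have h2 : h + n + 1 - (h + 1) = n := by omega
  rw [h1, h2, rewardToGo]

lemma occ_nonneg {μ : S → ℝ} {P : ℕ → S → S → ℝ} (hμ : ∀ s, 0 ≤ μ s)
    (hP : ∀ h s s', 0 ≤ P h s s') (h : ℕ) (s : S) : 0 ≤ occ μ P h s := by
  induction h generalizing s with
  | zero => exact hμ s
  | succ h ih => exact Finset.sum_nonneg fun t _ => mul_nonneg (ih t) (hP _ _ _)

lemma sum_occ_succ_mul (μ : S → ℝ) (P : ℕ → S → S → ℝ) (h : ℕ) (f : S → ℝ) :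
    ∑ s', occ μ P (h + 1) s' * f s' = ∑ s, occ μ P h s * ∑ s', P h s s' * f s' := by
  simp only [occ, Finset.sum_mul, Finset.mul_sum]
  rw [Finset.sum_comm]
  exact Finset.sum_congr rfl fun s _ => Finset.sum_congr rfl fun s' _ => by ring

lemma sum_occ {μ : S → ℝ} {P : ℕ → S → S → ℝ} (hμ : ∑ s, μ s = 1)
    (hP : ∀ h s, ∑ s', P h s s' = 1) (h : ℕ) : ∑ s, occ μ P h s = 1 := by
  induction h with
  | zero => exact hμ
  | succ h ih =>
    have := sum_occ_succ_mul μ P h (fun _ => 1)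
    simpa [hP, ih] using this

/-- Telescoping: integrating the Bellman defect of `V` against the occupancy measures leaves only
the boundary terms. -/
lemma sum_occ_bellman_defect (μ : S → ℝ) (P : ℕ → S → S → ℝ) (V : ℕ → S → ℝ) (H : ℕ) :
    ∑ h ∈ Finset.range H, ∑ s, occ μ P h s * (V h s - ∑ s', P h s s' * V (h + 1) s') =
      ∑ s, μ s * V 0 s - ∑ s, occ μ P H s * V H s := by
  have : ∀ h, ∑ s, occ μ P h s * (V h s - ∑ s', P h s s' * V (h + 1) s') =
      ∑ s, occ μ P h s * V h s - ∑ s, occ μ P (h + 1) s * V (h + 1) s := fun h => by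
    rw [sum_occ_succ_mul, ← Finset.sum_sub_distrib]
    exact Finset.sum_congr rfl fun s _ => by ring
  simp only [this]
  exact Finset.sum_range_sub' (fun h => ∑ s, occ μ P h s * V h s) H

lemma exists_isPathUpTo_of_occ_pos {μ : S → ℝ} {P : ℕ → S → S → ℝ} (hμ : ∀ s, 0 ≤ μ s)
    (hP : ∀ h s s', 0 ≤ P h s s') {h : ℕ} {s : S} (hs : 0 < occ μ P h s) :
    ∃ σ, IsPathUpTo μ P h σ ∧ σ h = s := by
  classical
  induction h generalizing s with
  | zero => exact ⟨fun _ => s, ⟨hs, by simp⟩, rfl⟩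
  | succ h ih =>
    obtain ⟨t, -, ht⟩ : ∃ t ∈ Finset.univ, 0 < occ μ P h t * P h t s := by
      by_contra! hcon
      exact absurd (Finset.sum_nonpos hcon) (not_le.2 hs)
    have ht0 := occ_nonneg hμ hP h t
    obtain ⟨σ, hσ, rfl⟩ := ih (pos_of_mul_pos_left ht (hP h t s))
    have hPt := pos_of_mul_pos_right ht ht0
    exact ⟨_, hσ.update hPt, by simp⟩

lemma IsPathUpTo.exists_extend {μ : S → ℝ} {P : ℕ → S → S → ℝ}
    (hP1 : ∀ h s, ∑ s', P h s s' = 1) {h : ℕ} {σ : ℕ → S}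
    (hσ : IsPathUpTo μ P h σ) {n : ℕ} (hn : h ≤ n) :
    ∃ σ', IsPathUpTo μ P n σ' ∧ ∀ k ≤ h, σ' k = σ k := by
  induction n, hn using Nat.le_induction with
  | base => exact ⟨σ, hσ, fun _ _ => rfl⟩
  | succ n hn ih =>
    obtain ⟨σ', h1, h2⟩ := ih
    obtain ⟨s, -, hs⟩ : ∃ s ∈ Finset.univ, 0 < P n (σ' n) s := by
      by_contra! hcon
      have := Finset.sum_nonpos hcon
      rw [hP1] at this
      linarith
    refine ⟨Function.update σ' (n + 1) s, h1.update hs, fun k hk => ?_⟩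
    rw [Function.update_of_ne (by omega)]
    exact h2 k hk

/-- If the rewards along every path of positive probability are dominated by `u`, with
`∑ u ≤ 1`, then the reward to go of a second chain whose transitions are supported on those of the
first one stays within `[0, 1]`, at every state which the first chain can reach. More precisely
it is at most what `u` has left over from the past. -/
lemma rewardToGo_mem_Icc_of_isPath {μ : S → ℝ} {P P' : ℕ → S → S → ℝ} {r' u : ℕ → S → ℝ} {H : ℕ}
    (hP : ∀ h s s', 0 ≤ P h s s')
    (hP' : ∀ h s s', 0 ≤ P' h s s') (hP'1 : ∀ h s, ∑ s', P' h s s' = 1)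
    (hPP' : ∀ h s s', P h s s' = 0 → P' h s s' = 0)
    (hr' : ∀ h < H, ∀ σ, IsPathUpTo μ P h σ → 0 ≤ r' h (σ h) ∧ r' h (σ h) ≤ u h (σ h))
    (hu : ∀ σ, IsPathUpTo μ P H σ → ∑ k ∈ Finset.range H, u k (σ k) ≤ 1)
    {h : ℕ} (hh : h ≤ H) {σ : ℕ → S} (hσ : IsPathUpTo μ P h σ) :
    0 ≤ rewardToGo P' r' (H - h) h (σ h) ∧
      rewardToGo P' r' (H - h) h (σ h) ≤ 1 - ∑ k ∈ Finset.range h, u k (σ k) := by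
  classical
  induction hh using Nat.decreasingInduction generalizing σ with
  | self =>
    simp only [Nat.sub_self, rewardToGo]
    exact ⟨le_rfl, by linarith [hu σ hσ]⟩
  | of_succ h hlt ih =>
    rw [rewardToGo_bellman P' r' hlt]
    have hr := hr' h hlt σ hσ
    have key : ∀ s', 0 < P h (σ h) s' →
        0 ≤ rewardToGo P' r' (H - (h + 1)) (h + 1) s' ∧
        rewardToGo P' r' (H - (h + 1)) (h + 1) s' ≤
          1 - ∑ k ∈ Finset.range (h + 1), u k (σ k) := fun s' hs' => by
      have := ih (hσ.update hs')
      rw [Function.update_self] at this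
      refine ⟨this.1, this.2.trans_eq ?_⟩
      congr 1
      refine Finset.sum_congr rfl fun k hk => ?_
      rw [Function.update_of_ne (by have := Finset.mem_range.1 hk; omega)]
    have hzero : ∀ s', ¬ 0 < P h (σ h) s' → P' h (σ h) s' = 0 := fun s' hs' =>
      hPP' _ _ _ (le_antisymm (not_lt.1 hs') (hP _ _ _))
    constructor
    · refine add_nonneg hr.1 (Finset.sum_nonneg fun s' _ => ?_)
      by_cases hs' : 0 < P h (σ h) s'
      · exact mul_nonneg (hP' _ _ _) (key s' hs').1
      · simp [hzero s' hs']
    · have : ∑ s', P' h (σ h) s' * rewardToGo P' r' (H - (h + 1)) (h + 1) s' ≤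
          ∑ s', P' h (σ h) s' * (1 - ∑ k ∈ Finset.range (h + 1), u k (σ k)) := by
        refine Finset.sum_le_sum fun s' _ => ?_
        by_cases hs' : 0 < P h (σ h) s'
        · exact mul_le_mul_of_nonneg_left (key s' hs').2 (hP' _ _ _)
        · simp [hzero s' hs']
      rw [← Finset.sum_mul, hP'1, one_mul, Finset.sum_range_succ] at this
      linarith [hr.2]

lemma sum_occ_mul_reward_eq (μ : S → ℝ) (P : ℕ → S → S → ℝ) (r : ℕ → S → ℝ) (H : ℕ) :
    ∑ h ∈ Finset.range H, ∑ s, occ μ P h s * r h s = ∑ s, μ s * rewardToGo P r H 0 s := by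
  have := sum_occ_bellman_defect μ P (fun h => rewardToGo P r (H - h) h) H
  simp only [Nat.sub_self, Nat.sub_zero, rewardToGo, mul_zero, Finset.sum_const_zero,
    sub_zero] at this
  rw [← this]
  refine Finset.sum_congr rfl fun h hh => Finset.sum_congr rfl fun s _ => ?_
  rw [rewardToGo_bellman P r (Finset.mem_range.1 hh)]
  ring

/-! ### Perturbation of the value under Bernstein-type deviations -/

/-- `x` estimates `p` up to a Bernstein-type error with rate `τ`. -/
def BernsteinClose (τ x p : ℝ) : Prop := |x - p| ≤ 2 * √(τ * p) + 2 * τ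

/-- The arithmetic-geometric mean inequality trades the square root in `BernsteinClose` against a
free parameter `η`. -/
lemma BernsteinClose.abs_sub_mul_le {τ x p η D : ℝ} (hx : BernsteinClose τ x p) (hτ : 0 ≤ τ)
    (hp : 0 ≤ p) (hη : 0 < η) (hD0 : 0 ≤ D) (hD : D ≤ 1) :
    |x - p| * D ≤ η * (p * D ^ 2) + τ * (1 / η + 2) := by
  have h1 : 2 * √(τ * p) * D ≤ η * (p * D ^ 2) + τ / η := by
    have e1 : √(τ * p) = √τ * √p := Real.sqrt_mul hτ p
    have e2 : √τ ^ 2 = τ := Real.sq_sqrt hτ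
    have e3 : √p ^ 2 = p := Real.sq_sqrt hp
    have e4 : η * (p * D ^ 2) + τ / η - 2 * √(τ * p) * D = (η * (√p * D) - √τ) ^ 2 / η := by
      rw [e1]
      nth_rewrite 1 [← e2, ← e3]
      field_simp
      ring
    have : 0 ≤ (η * (√p * D) - √τ) ^ 2 / η := by positivity
    linarith
  calc |x - p| * D ≤ (2 * √(τ * p) + 2 * τ) * D := mul_le_mul_of_nonneg_right hx hD0
    _ ≤ 2 * √(τ * p) * D + 2 * τ := by nlinarith
    _ ≤ η * (p * D ^ 2) + τ * (1 / η + 2) := by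
      rw [mul_add, mul_one_div]; linarith

/-- A one-step Bernstein bound: the change of the mean of `V` is at most `η` times its variance
under `p`, plus an error of order `τ`. -/
lemma abs_sum_sub_mul_le_variance {τ η : ℝ} {p p' V : S → ℝ} (hτ : 0 ≤ τ) (hη : 0 < η)
    (hp : ∀ s, 0 ≤ p s) (hp1 : ∑ s, p s = 1) (hp'1 : ∑ s, p' s = 1)
    (hpp' : ∀ s, p s = 0 → p' s = 0) (hclose : ∀ s, BernsteinClose τ (p' s) (p s))
    (hV : ∀ s, 0 < p s → 0 ≤ V s ∧ V s ≤ 1) :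
    |∑ s, (p' s - p s) * V s| ≤
      η * (∑ s, p s * V s ^ 2 - (∑ s, p s * V s) ^ 2) +
        Fintype.card S * (τ * (1 / η + 2)) := by
  set m := ∑ s, p s * V s with hm
  have hpV : ∀ s, 0 ≤ p s * V s ∧ p s * V s ≤ p s := fun s => by
    rcases (hp s).eq_or_lt with h | h
    · simp [← h]
    · exact ⟨mul_nonneg h.le (hV s h).1, mul_le_of_le_one_right h.le (hV s h).2⟩
  have hm0 : 0 ≤ m := Finset.sum_nonneg fun s _ => (hpV s).1
  have hm1 : m ≤ 1 := by
    rw [← hp1]; exact Finset.sum_le_sum fun s _ => (hpV s).2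
  -- `p` and `p'` have the same total mass, so `V` may be centred at its mean
  have e1 : ∑ s, (p' s - p s) * V s = ∑ s, (p' s - p s) * (V s - m) := by
    simp only [mul_sub, Finset.sum_sub_distrib, ← Finset.sum_mul, hp1, hp'1]
    ring
  have e2 : ∑ s, p s * V s ^ 2 - m ^ 2 = ∑ s, p s * |V s - m| ^ 2 := by
    have : ∀ s, p s * |V s - m| ^ 2 = p s * V s ^ 2 - 2 * m * (p s * V s) + m ^ 2 * p s :=
      fun s => by rw [sq_abs]; ring
    simp only [this, Finset.sum_add_distrib, Finset.sum_sub_distrib, ← Finset.mul_sum, hp1, ← hm]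
    ring
  rw [e1, e2]
  calc |∑ s, (p' s - p s) * (V s - m)| ≤ ∑ s, |(p' s - p s) * (V s - m)| :=
        Finset.abs_sum_le_sum_abs _ _
    _ ≤ ∑ s, (η * (p s * |V s - m| ^ 2) + τ * (1 / η + 2)) := by
      refine Finset.sum_le_sum fun s _ => ?_
      rw [abs_mul]
      rcases (hp s).eq_or_lt with h | h
      · rw [hpp' s h.symm, ← h]
        simp only [sub_self, abs_zero, zero_mul, mul_zero, zero_add]
        positivity
      · refine (hclose s).abs_sub_mul_le hτ (hp s) hη (abs_nonneg _) ?_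
        have := hV s h
        exact abs_le.2 ⟨by linarith, by linarith⟩
    _ = _ := by
      rw [Finset.sum_add_distrib, ← Finset.mul_sum, Finset.sum_const, nsmul_eq_mul,
        Finset.card_univ]

/-- Inequalities between expected values at time `h` need to be checked only at the states that a
path of positive probability reaches. -/
lemma sum_occ_mul_le_of_path {μ : S → ℝ} {P : ℕ → S → S → ℝ} (hμ : ∀ s, 0 ≤ μ s)
    (hP : ∀ h s s', 0 ≤ P h s s') {h : ℕ} {f g : S → ℝ}
    (hfg : ∀ σ, IsPathUpTo μ P h σ → f (σ h) ≤ g (σ h)) :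
    ∑ s, occ μ P h s * f s ≤ ∑ s, occ μ P h s * g s := by
  refine Finset.sum_le_sum fun s _ => ?_
  rcases (occ_nonneg hμ hP h s).eq_or_lt with h0 | h0
  · simp [← h0]
  · obtain ⟨σ, hσ, rfl⟩ := exists_isPathUpTo_of_occ_pos hμ hP h0
    exact mul_le_mul_of_nonneg_left (hfg σ hσ) h0.le

/-- **Horizon-free perturbation bound.** Let all transition probabilities, rewards and initial
probabilities of a Markov reward chain be known up to Bernstein-type errors with rate `τ`, and let
the total reward along its paths be at most `1`. Then the value is off by at most
`7 η + 3 |S| H τ (1 / η + 2)`. The horizon enters only through `H τ`, because the one-step errors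
are controlled by one-step variances of the perturbed value function, and the sum of these
variances along a trajectory is bounded by a constant. -/
theorem abs_value_sub_value_le {μ μ' : S → ℝ} {P P' : ℕ → S → S → ℝ} {r r' u : ℕ → S → ℝ} {H : ℕ}
    {τ η : ℝ} (hH : 0 < H) (hτ : 0 ≤ τ) (hη : 0 < η) (hη4 : η ≤ 1 / 4)
    (hC : Fintype.card S * (H * τ * (1 / η + 2)) ≤ 1 / 4)
    (hμ : ∀ s, 0 ≤ μ s) (hμ1 : ∑ s, μ s = 1)
    (hμμ' : ∀ s, μ s = 0 → μ' s = 0)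
    (hP : ∀ h s s', 0 ≤ P h s s') (hP1 : ∀ h s, ∑ s', P h s s' = 1)
    (hP' : ∀ h s s', 0 ≤ P' h s s') (hP'1 : ∀ h s, ∑ s', P' h s s' = 1)
    (hPP' : ∀ h s s', P h s s' = 0 → P' h s s' = 0)
    (hr : ∀ h < H, ∀ σ, IsPathUpTo μ P h σ → 0 ≤ r h (σ h) ∧ r h (σ h) ≤ u h (σ h))
    (hr' : ∀ h < H, ∀ σ, IsPathUpTo μ P h σ → 0 ≤ r' h (σ h) ∧ r' h (σ h) ≤ u h (σ h))
    (hu : ∀ σ, IsPathUpTo μ P H σ → ∑ k ∈ Finset.range H, u k (σ k) ≤ 1)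
    (hcμ : ∀ s, BernsteinClose τ (μ' s) (μ s))
    (hcP : ∀ h s s', BernsteinClose τ (P' h s s') (P h s s'))
    (hcr : ∀ h < H, ∀ σ, IsPathUpTo μ P h σ → BernsteinClose τ (r' h (σ h)) (r h (σ h))) :
    |∑ h ∈ Finset.range H, ∑ s, occ μ' P' h s * r' h s -
        ∑ h ∈ Finset.range H, ∑ s, occ μ P h s * r h s| ≤
      7 * η + 3 * (Fintype.card S * (H * τ * (1 / η + 2))) := by
  set V : ℕ → S → ℝ := fun h => rewardToGo P' r' (H - h) h with hVdef
  set c : ℝ := τ * (1 / η + 2) with hc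
  set C : ℝ := Fintype.card S * (H * τ * (1 / η + 2)) with hCdef
  have hc0 : 0 ≤ c := by positivity
  have hS1 : (1 : ℝ) ≤ Fintype.card S := by
    have : Nonempty S := by
      by_contra hcon
      rw [not_nonempty_iff] at hcon
      simp at hμ1
    exact_mod_cast Fintype.card_pos
  have hH1 : (1 : ℝ) ≤ H := by exact_mod_cast hH
  have hCc : C = H * (Fintype.card S * c) := by rw [hCdef, hc]; ring
  have hSc : c ≤ Fintype.card S * c := le_mul_of_one_le_left hc0 hS1
  have hHSc : Fintype.card S * c ≤ C := by
    rw [hCc]; exact le_mul_of_one_le_left (by positivity) hH1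
  have hV : ∀ h ≤ H, ∀ σ, IsPathUpTo μ P h σ → 0 ≤ V h (σ h) ∧ V h (σ h) ≤ 1 := by
    intro h hh σ hσ
    have h1 := rewardToGo_mem_Icc_of_isPath hP hP' hP'1 hPP' hr' hu hh hσ
    refine ⟨h1.1, h1.2.trans ?_⟩
    have : 0 ≤ ∑ k ∈ Finset.range h, u k (σ k) := by
      refine Finset.sum_nonneg fun k hk => ?_
      have hk := Finset.mem_range.1 hk
      have := hr' k (by omega) σ ⟨hσ.1, fun j hj => hσ.2 j (by omega)⟩
      linarith
    linarith
  have hVsucc : ∀ h < H, ∀ σ, IsPathUpTo μ P h σ → ∀ s', 0 < P h (σ h) s' →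
      0 ≤ V (h + 1) s' ∧ V (h + 1) s' ≤ 1 := fun h hh σ hσ s' hs' => by
    classical
    simpa using hV (h + 1) hh _ (hσ.update hs')
  have hVH : ∀ s, V H s = 0 := fun s => by simp [hVdef, rewardToGo]
  have hV0 : ∀ s, V 0 s = rewardToGo P' r' H 0 s := fun s => by simp [hVdef]
  -- expected total rewards under the unperturbed chain
  have htotal : ∀ q : ℕ → S → ℝ,
      (∀ h < H, ∀ σ, IsPathUpTo μ P h σ → 0 ≤ q h (σ h) ∧ q h (σ h) ≤ u h (σ h)) →
      ∑ h ∈ Finset.range H, ∑ s, occ μ P h s * q h s ≤ 1 := by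
    intro q hq
    rw [sum_occ_mul_reward_eq]
    have : ∑ s, occ μ P 0 s * rewardToGo P q H 0 s ≤ ∑ s, occ μ P 0 s * 1 := by
      refine sum_occ_mul_le_of_path hμ hP fun σ hσ => ?_
      simpa using (rewardToGo_mem_Icc_of_isPath hP hP hP1 (fun _ _ _ h => h) hq hu
        (Nat.zero_le H) hσ).2
    simpa [occ, hμ1] using this
  -- the one-step errors, one-step means and one-step variances
  set e : ℕ → S → ℝ := fun h s => ∑ s', (P' h s s' - P h s s') * V (h + 1) s' with he
  set m : ℕ → S → ℝ := fun h s => ∑ s', P h s s' * V (h + 1) s' with hm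
  set v : ℕ → S → ℝ := fun h s => ∑ s', P h s s' * V (h + 1) s' ^ 2 - m h s ^ 2 with hv
  -- Bellman's equation for `V`, written with the transitions of the unperturbed chain
  have hbell : ∀ h < H, ∀ s, V h s = r' h s + e h s + m h s := fun h hh s => by
    simp only [hVdef, he, hm]
    rw [rewardToGo_bellman P' r' hh, add_assoc, ← Finset.sum_add_distrib]
    congr 1
    exact Finset.sum_congr rfl fun s' _ => by ring
  set T := ∑ h ∈ Finset.range H, ∑ s, occ μ P h s * v h s with hT
  set E := ∑ h ∈ Finset.range H, ∑ s, occ μ P h s * |e h s| with hE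
  have hconst : ∀ a : ℝ, ∑ h ∈ Finset.range H, ∑ s, occ μ P h s * a = H * a := fun a => by
    simp [← Finset.sum_mul, sum_occ hμ1 hP1]
  have hET : E ≤ η * T + C := by
    have : E ≤ ∑ h ∈ Finset.range H, ∑ s, occ μ P h s * (η * v h s + Fintype.card S * c) := by
      refine Finset.sum_le_sum fun h hh => sum_occ_mul_le_of_path hμ hP fun σ hσ => ?_
      exact abs_sum_sub_mul_le_variance hτ hη (hP h _) (hP1 h _) (hP'1 h _) (hPP' h _)
        (hcP h _) (hVsucc h (Finset.mem_range.1 hh) σ hσ)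
    refine this.trans_eq ?_
    simp only [mul_add, Finset.sum_add_distrib]
    rw [hconst, hT, Finset.mul_sum, hCc]
    congr 1
    refine Finset.sum_congr rfl fun h _ => ?_
    rw [Finset.mul_sum]
    exact Finset.sum_congr rfl fun s _ => by ring
  -- law of total variance, with the perturbed value function along the unperturbed chain
  have hTE : T ≤ 2 + 2 * E := by
    have htel := sum_occ_bellman_defect μ P (fun h s => V h s ^ 2) H
    -- the second moments of `V` telescope, from a nonnegative value to `0` at time `H`
    have hdef : ∑ h ∈ Finset.range H, ∑ s, occ μ P h s * (V h s ^ 2 -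
        ∑ s', P h s s' * V (h + 1) s' ^ 2) ≥ 0 := by
      rw [htel]
      simp only [hVH]
      have : 0 ≤ ∑ s, μ s * V 0 s ^ 2 :=
        Finset.sum_nonneg fun s _ => mul_nonneg (hμ s) (sq_nonneg _)
      simpa using this
    have hsplit : T + ∑ h ∈ Finset.range H, ∑ s, occ μ P h s * (V h s ^ 2 -
        ∑ s', P h s s' * V (h + 1) s' ^ 2) =
        ∑ h ∈ Finset.range H, ∑ s, occ μ P h s * (V h s ^ 2 - m h s ^ 2) := by
      rw [hT, ← Finset.sum_add_distrib]
      refine Finset.sum_congr rfl fun h _ => ?_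
      rw [← Finset.sum_add_distrib]
      exact Finset.sum_congr rfl fun s _ => by simp only [hv]; ring
    have hbd : ∑ h ∈ Finset.range H, ∑ s, occ μ P h s * (V h s ^ 2 - m h s ^ 2) ≤
        ∑ h ∈ Finset.range H, ∑ s, occ μ P h s * (2 * (r' h s + |e h s|)) := by
      refine Finset.sum_le_sum fun h hh => sum_occ_mul_le_of_path hμ hP fun σ hσ => ?_
      have hh := Finset.mem_range.1 hh
      have h1 := hV h hh.le σ hσ
      have hs := hVsucc h hh σ hσ
      have hterm : ∀ s', 0 ≤ P h (σ h) s' * V (h + 1) s' ∧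
          P h (σ h) s' * V (h + 1) s' ≤ P h (σ h) s' := fun s' => by
        rcases (hP h (σ h) s').eq_or_lt with h0 | h0
        · simp [← h0]
        · exact ⟨mul_nonneg h0.le (hs s' h0).1, mul_le_of_le_one_right h0.le (hs s' h0).2⟩
      have hm0 : 0 ≤ m h (σ h) := Finset.sum_nonneg fun s' _ => (hterm s').1
      have hm1 : m h (σ h) ≤ 1 := by
        rw [← hP1 h (σ h)]; exact Finset.sum_le_sum fun s' _ => (hterm s').2
      have hb := hbell h hh (σ h)
      have hr0 := (hr' h hh σ hσ).1
      have hfac : V h (σ h) ^ 2 - m h (σ h) ^ 2 =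
          (V h (σ h) + m h (σ h)) * (r' h (σ h) + e h (σ h)) := by
        have : r' h (σ h) + e h (σ h) = V h (σ h) - m h (σ h) := by linarith
        rw [this]; ring
      rw [hfac]
      calc (V h (σ h) + m h (σ h)) * (r' h (σ h) + e h (σ h))
          ≤ (V h (σ h) + m h (σ h)) * (r' h (σ h) + |e h (σ h)|) := by
            gcongr
            · linarith
            · exact le_abs_self _
        _ ≤ 2 * (r' h (σ h) + |e h (σ h)|) := by
            gcongr
            linarith
    have hsum : ∑ h ∈ Finset.range H, ∑ s, occ μ P h s * (2 * (r' h s + |e h s|)) =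
        2 * ∑ h ∈ Finset.range H, ∑ s, occ μ P h s * r' h s + 2 * E := by
      rw [hE, ← mul_add, ← Finset.sum_add_distrib, Finset.mul_sum]
      refine Finset.sum_congr rfl fun h _ => ?_
      rw [← Finset.sum_add_distrib, Finset.mul_sum]
      exact Finset.sum_congr rfl fun s _ => by ring
    have := htotal r' hr'
    linarith
  -- `hET` and `hTE` bound `T` by `2 + T / 2 + 1 / 2`
  have hE5 : E ≤ 5 * η + C := by
    have h0 : 0 ≤ E := Finset.sum_nonneg fun h _ => Finset.sum_nonneg fun s _ =>
      mul_nonneg (occ_nonneg hμ hP h s) (abs_nonneg _)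
    have hT5 : T ≤ 5 := by
      by_contra! hcon
      nlinarith
    nlinarith
  have hR : |∑ h ∈ Finset.range H, ∑ s, occ μ P h s * (r' h s - r h s)| ≤ η + C := by
    calc |∑ h ∈ Finset.range H, ∑ s, occ μ P h s * (r' h s - r h s)|
        ≤ ∑ h ∈ Finset.range H, ∑ s, occ μ P h s * |r' h s - r h s| := by
          refine (Finset.abs_sum_le_sum_abs _ _).trans (Finset.sum_le_sum fun h _ => ?_)
          refine (Finset.abs_sum_le_sum_abs _ _).trans (Finset.sum_le_sum fun s _ => ?_)
          rw [abs_mul, abs_of_nonneg (occ_nonneg hμ hP h s)]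
      _ ≤ ∑ h ∈ Finset.range H, ∑ s, occ μ P h s * (η * r h s + c) := by
          refine Finset.sum_le_sum fun h hh => sum_occ_mul_le_of_path hμ hP fun σ hσ => ?_
          have hh := Finset.mem_range.1 hh
          simpa only [mul_one, one_pow] using
            (hcr h hh σ hσ).abs_sub_mul_le hτ (hr h hh σ hσ).1 hη zero_le_one le_rfl
      _ = η * ∑ h ∈ Finset.range H, ∑ s, occ μ P h s * r h s + H * c := by
          simp only [mul_add, Finset.sum_add_distrib]
          rw [hconst, Finset.mul_sum]
          congr 1
          refine Finset.sum_congr rfl fun h _ => ?_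
          rw [Finset.mul_sum]
          exact Finset.sum_congr rfl fun s _ => by ring
      _ ≤ η + C := by
          have h1 := htotal r hr
          have h2 : H * c ≤ C := by rw [hCc]; gcongr
          nlinarith
  have hI : |∑ s, (μ' s - μ s) * V 0 s| ≤ η + C := by
    calc |∑ s, (μ' s - μ s) * V 0 s| ≤ ∑ s, |(μ' s - μ s) * V 0 s| :=
          Finset.abs_sum_le_sum_abs _ _
      _ ≤ ∑ s, (η * μ s + c) := by
          refine Finset.sum_le_sum fun s _ => ?_
          rw [abs_mul]
          rcases (hμ s).eq_or_lt with h0 | h0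
          · rw [hμμ' s h0.symm, ← h0]
            simpa using hc0
          · have h1 := hV 0 (Nat.zero_le H) (fun _ => s) ⟨h0, by simp⟩
            rw [abs_of_nonneg h1.1]
            refine ((hcμ s).abs_sub_mul_le hτ (hμ s) hη h1.1 h1.2).trans ?_
            have : μ s * V 0 s ^ 2 ≤ μ s :=
              mul_le_of_le_one_right h0.le (pow_le_one₀ h1.1 h1.2)
            gcongr
      _ = η + Fintype.card S * c := by
          rw [Finset.sum_add_distrib, ← Finset.mul_sum, hμ1, Finset.sum_const, nsmul_eq_mul,
            Finset.card_univ, mul_one]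
      _ ≤ η + C := by gcongr
  have hEe : |∑ h ∈ Finset.range H, ∑ s, occ μ P h s * e h s| ≤ E := by
    refine (Finset.abs_sum_le_sum_abs _ _).trans (Finset.sum_le_sum fun h _ => ?_)
    refine (Finset.abs_sum_le_sum_abs _ _).trans (Finset.sum_le_sum fun s _ => ?_)
    rw [abs_mul, abs_of_nonneg (occ_nonneg hμ hP h s)]
  -- the simulation identity
  have hsim : ∑ h ∈ Finset.range H, ∑ s, occ μ' P' h s * r' h s -
      ∑ h ∈ Finset.range H, ∑ s, occ μ P h s * r h s =
      ∑ h ∈ Finset.range H, ∑ s, occ μ P h s * (r' h s - r h s) +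
      ∑ h ∈ Finset.range H, ∑ s, occ μ P h s * e h s + ∑ s, (μ' s - μ s) * V 0 s := by
    have htel := sum_occ_bellman_defect μ P V H
    simp only [hVH, mul_zero, Finset.sum_const_zero, sub_zero] at htel
    rw [sum_occ_mul_reward_eq μ' P']
    simp only [← hV0, sub_mul, Finset.sum_sub_distrib]
    rw [← htel, ← sub_eq_zero]
    have : ∑ h ∈ Finset.range H, ∑ s, occ μ P h s * (V h s - ∑ s', P h s s' * V (h + 1) s') =
        ∑ h ∈ Finset.range H, ∑ s, occ μ P h s * r' h s +
        ∑ h ∈ Finset.range H, ∑ s, occ μ P h s * e h s := by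
      rw [← Finset.sum_add_distrib]
      refine Finset.sum_congr rfl fun h hh => ?_
      rw [← Finset.sum_add_distrib]
      refine Finset.sum_congr rfl fun s _ => ?_
      rw [hbell h (Finset.mem_range.1 hh) s]
      ring
    rw [this]
    simp only [mul_sub, Finset.sum_sub_distrib]
    ring
  rw [hsim]
  calc _ ≤ |∑ h ∈ Finset.range H, ∑ s, occ μ P h s * (r' h s - r h s)| +
      |∑ h ∈ Finset.range H, ∑ s, occ μ P h s * e h s| + |∑ s, (μ' s - μ s) * V 0 s| :=
        abs_add_three _ _ _
    _ ≤ 7 * η + 3 * C := by linarith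

end Chain

noncomputable section

/-! ### Trajectories and occupancy measures -/

section PathWeight

variable {S : Type*}

/-- The probability that the chain starts with the states `σ 0, …, σ n`. -/
def pathWeight (μ : S → ℝ) (P : ℕ → S → S → ℝ) (n : ℕ) (σ : Fin (n + 1) → S) : ℝ :=
  μ (σ 0) * ∏ k : Fin n, P k (σ k.castSucc) (σ k.succ)

lemma pathWeight_snoc (μ : S → ℝ) (P : ℕ → S → S → ℝ) (n : ℕ) (τ : Fin (n + 1) → S) (s : S) :
    pathWeight μ P (n + 1) (Fin.snoc τ s : Fin (n + 2) → S) =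
      pathWeight μ P n τ * P n (τ (Fin.last n)) s := by
  have h0 : (Fin.snoc τ s : Fin (n + 2) → S) 0 = τ 0 := by
    rw [← Fin.castSucc_zero]; exact Fin.snoc_castSucc (α := fun _ => S) s τ 0
  have h1 : ∀ k : Fin (n + 1), (Fin.snoc τ s : Fin (n + 2) → S) k.castSucc = τ k := fun k =>
    Fin.snoc_castSucc (α := fun _ => S) s τ k
  have h2 : (Fin.snoc τ s : Fin (n + 2) → S) (Fin.last (n + 1)) = s :=
    Fin.snoc_last (α := fun _ => S) s τ
  rw [pathWeight, pathWeight, Fin.prod_univ_castSucc, h0, mul_assoc]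
  simp only [h1, Fin.succ_last, h2, Fin.succ_castSucc, Fin.val_castSucc, Fin.val_last]

lemma sum_snoc [Fintype S] {n : ℕ} (F : (Fin (n + 2) → S) → ℝ) :
    ∑ σ, F σ = ∑ τ : Fin (n + 1) → S, ∑ s, F (Fin.snoc τ s : Fin (n + 2) → S) := by
  rw [← (Fin.snocEquiv (fun _ : Fin (n + 2) => S)).sum_comp, Fintype.sum_prod_type_right]
  rfl

lemma sum_pathWeight_mul_last [Fintype S] (μ : S → ℝ) (P : ℕ → S → S → ℝ) (n : ℕ) (f : S → ℝ) :
    ∑ σ, pathWeight μ P n σ * f (σ (Fin.last n)) = ∑ s, occ μ P n s * f s := by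
  induction n generalizing f with
  | zero =>
    rw [← (Equiv.funUnique (Fin 1) S).symm.sum_comp]
    simp [pathWeight, occ]
  | succ n ih =>
    rw [sum_snoc, sum_occ_succ_mul, ← ih]
    refine Finset.sum_congr rfl fun τ _ => ?_
    rw [Finset.mul_sum]
    refine Finset.sum_congr rfl fun s _ => ?_
    rw [pathWeight_snoc, Fin.snoc_last (α := fun _ => S) s τ, mul_assoc]

lemma sum_pathWeight_mul_sum [Fintype S] (μ : S → ℝ) (P : ℕ → S → S → ℝ)
    (hP1 : ∀ h s, ∑ s', P h s s' = 1) (n : ℕ) (f : ℕ → S → ℝ) :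
    ∑ σ, pathWeight μ P n σ * ∑ h : Fin n, f h (σ h.castSucc) =
      ∑ h ∈ Finset.range n, ∑ s, occ μ P h s * f h s := by
  induction n with
  | zero => simp
  | succ n ih =>
    rw [sum_snoc, Finset.sum_range_succ, ← ih, ← sum_pathWeight_mul_last, ← Finset.sum_add_distrib]
    refine Finset.sum_congr rfl fun τ _ => ?_
    have : ∀ s, pathWeight μ P (n + 1) (Fin.snoc τ s : Fin (n + 2) → S) *
        ∑ h : Fin (n + 1), f h ((Fin.snoc τ s : Fin (n + 2) → S) h.castSucc) =
        pathWeight μ P n τ * (∑ h : Fin (n + 1), f h (τ h)) * P n (τ (Fin.last n)) s := fun s => by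
      rw [pathWeight_snoc]
      simp only [Fin.snoc_castSucc (α := fun _ => S) s τ]
      ring
    simp only [this]
    rw [← Finset.mul_sum, hP1, mul_one, Fin.sum_univ_castSucc, mul_add]
    simp

end PathWeight

namespace MDP

variable {S A : Type*} {H : ℕ}

/-- Extension of a policy to all times, by an arbitrary action from time `H` on. -/
def extendPolicy [Nonempty A] (π : Policy S A H) (h : ℕ) (s : S) : A :=
  if hh : h < H then π ⟨h, hh⟩ s else Classical.arbitrary A

@[simp] lemma extendPolicy_val [Nonempty A] (π : Policy S A H) (h : Fin H) (s : S) :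
    extendPolicy π h s = π h s := by
  simp [extendPolicy]

/-- Real-valued transition matrices of the Markov chain induced by a policy. -/
def kernel [Nonempty A] (M : MDP S A H) (π : Policy S A H) (h : ℕ) (s s' : S) : ℝ :=
  (M.trans s (extendPolicy π h s) s').toReal

/-- Initial probabilities as real numbers. -/
def initReal (M : MDP S A H) (s : S) : ℝ := (M.init s).toReal

/-- Expected reward of a state-action pair; `0` if the reward is not integrable, which cannot happen
at the pairs collected on a path of positive probability when the total reward is bounded. -/
def meanReward (M : MDP S A H) (s : S) (a : A) : ℝ := ∫ x, x ∂(M.reward s a : Measure ℝ)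

/-- Largest reward, up to null sets, of a state-action pair. It is meaningful only for rewards that
are bounded almost surely. -/
def supReward (M : MDP S A H) (s : S) (a : A) : ℝ := essSup id (M.reward s a : Measure ℝ)

lemma _root_.PMF.sum_toReal {X : Type*} [Fintype X] (p : PMF X) : ∑ x, (p x).toReal = 1 := by
  rw [← ENNReal.toReal_sum fun x _ => p.apply_ne_top x, ← tsum_fintype (L := .unconditional X),
    p.tsum_coe, ENNReal.toReal_one]

lemma kernel_nonneg [Nonempty A] (M : MDP S A H) (π : Policy S A H) (h : ℕ) (s s' : S) :
    0 ≤ M.kernel π h s s' := ENNReal.toReal_nonneg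

lemma sum_kernel [Fintype S] [Nonempty A] (M : MDP S A H) (π : Policy S A H) (h : ℕ) (s : S) :
    ∑ s', M.kernel π h s s' = 1 := (M.trans s _).sum_toReal

lemma toReal_stateSeqProb [Nonempty A] (M : MDP S A H) (π : Policy S A H)
    (σ : Fin (H + 1) → S) :
    (M.stateSeqProb π σ).toReal = pathWeight M.initReal (M.kernel π) H σ := by
  simp [stateSeqProb, pathWeight, initReal, kernel, ENNReal.toReal_mul, ENNReal.toReal_prod]

lemma stateSeqProb_ne_top (M : MDP S A H) (π : Policy S A H) (σ : Fin (H + 1) → S) :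
    M.stateSeqProb π σ ≠ ∞ :=
  ENNReal.mul_ne_top (PMF.apply_ne_top _ _) (ENNReal.prod_ne_top fun _ _ => PMF.apply_ne_top _ _)

lemma stateSeqProb_ne_zero_of_isPath [Nonempty A] (M : MDP S A H) (π : Policy S A H) {σ : ℕ → S}
    (hσ : IsPathUpTo M.initReal (M.kernel π) H σ) :
    M.stateSeqProb π (fun i => σ i) ≠ 0 := by
  have : 0 < (M.stateSeqProb π (fun i => σ i)).toReal := by
    rw [toReal_stateSeqProb, pathWeight]
    refine mul_pos hσ.1 (Finset.prod_pos fun k _ => ?_)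
    simpa using hσ.2 k k.2
  exact fun h => by simp [h] at this

/-- The value of a policy in terms of occupancy measures, provided that the rewards collected on
paths of positive probability are integrable. -/
lemma value_eq_sum_occ [Fintype S] [MeasurableSpace S] [DiscreteMeasurableSpace S] [Nonempty A]
    (M : MDP S A H) (π : Policy S A H)
    (hint : ∀ σ, M.stateSeqProb π σ ≠ 0 → ∀ h : Fin H,
      Integrable (fun x => x) (M.reward (σ h.castSucc) (π h (σ h.castSucc)) : Measure ℝ)) :
    M.value π = ∑ h ∈ Finset.range H, ∑ s, occ M.initReal (M.kernel π) h s *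
      M.meanReward s (extendPolicy π h s) := by
  rw [← sum_pathWeight_mul_sum _ _ (M.sum_kernel π) H fun h s =>
    M.meanReward s (extendPolicy π h s)]
  have hcomp : ∀ σ, M.stateSeqProb π σ ≠ 0 → ∀ h : Fin H,
      Integrable (fun τ : Traj S H => τ.2 h) ((Measure.dirac σ).prod
        (Measure.pi fun h : Fin H =>
          (M.reward (σ h.castSucc) (π h (σ h.castSucc)) : Measure ℝ))) ∧
      ∫ τ : Traj S H, τ.2 h ∂((Measure.dirac σ).prod
        (Measure.pi fun h : Fin H =>
          (M.reward (σ h.castSucc) (π h (σ h.castSucc)) : Measure ℝ))) =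
        M.meanReward (σ h.castSucc) (π h (σ h.castSucc)) := fun σ hσ h => by
    have hmp := (measurePreserving_eval (fun h : Fin H =>
      (M.reward (σ h.castSucc) (π h (σ h.castSucc)) : Measure ℝ)) h).comp
        (measurePreserving_snd (μ := Measure.dirac σ))
    refine ⟨(hmp.integrable_comp measurable_id.aestronglyMeasurable).2 (hint σ hσ h), ?_⟩
    rw [meanReward, ← hmp.map_eq, integral_map hmp.measurable.aemeasurable
      (f := fun x : ℝ => x) aestronglyMeasurable_id]
    rfl
  rw [value, trajLaw, integral_finsetSum_measure]
  · refine Finset.sum_congr rfl fun σ _ => ?_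
    rw [integral_smul_measure, toReal_stateSeqProb, smul_eq_mul]
    by_cases hσ : M.stateSeqProb π σ = 0
    · rw [← toReal_stateSeqProb, hσ]; simp
    · congr 1
      rw [integral_finsetSum _ fun h _ => (hcomp σ hσ h).1]
      exact Finset.sum_congr rfl fun h _ => by rw [(hcomp σ hσ h).2, extendPolicy_val]
  · intro σ _
    by_cases hσ : M.stateSeqProb π σ = 0
    · simp [hσ]
    · exact (integrable_finsetSum _ fun h _ => (hcomp σ hσ h).1).smul_measure
        (M.stateSeqProb_ne_top π σ)

/-! ### Consequences of a bounded total reward -/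

lemma BoundedTotalReward.ae_rewards [Fintype S] [MeasurableSpace S] [DiscreteMeasurableSpace S]
    {M : MDP S A H} (hM : M.BoundedTotalReward) (π : Policy S A H) {σ : Fin (H + 1) → S}
    (hσ : M.stateSeqProb π σ ≠ 0) :
    ∀ᵐ ρ ∂(Measure.pi fun h : Fin H =>
      (M.reward (σ h.castSucc) (π h (σ h.castSucc)) : Measure ℝ)),
      (∀ h : Fin H, ρ h ∈ Set.Icc (0 : ℝ) 1) ∧ ∑ h : Fin H, ρ h ≤ 1 := by
  have h1 := hM π
  set ν := Measure.pi fun h : Fin H =>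
      (M.reward (σ h.castSucc) (π h (σ h.castSucc)) : Measure ℝ) with hν
  have hac : (Measure.dirac σ).prod ν ≪ M.trajLaw π := by
    refine Measure.AbsolutelyContinuous.mk fun s _ hs => ?_
    rw [trajLaw, Measure.finsetSum_apply, Finset.sum_eq_zero_iff] at hs
    have := hs σ (Finset.mem_univ _)
    rw [Measure.smul_apply, smul_eq_mul, mul_eq_zero] at this
    exact this.resolve_left hσ
  have h2 := hac.ae_le h1
  rw [Measure.dirac_prod] at h2
  exact ae_of_ae_map measurable_prodMk_left.aemeasurable h2

/-- Along a path of positive probability all rewards lie in `[0, 1]` almost surely. -/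
lemma BoundedTotalReward.ae_mem_Icc [Fintype S] [MeasurableSpace S] [DiscreteMeasurableSpace S]
    {M : MDP S A H} (hM : M.BoundedTotalReward) (π : Policy S A H) {σ : Fin (H + 1) → S}
    (hσ : M.stateSeqProb π σ ≠ 0) (h : Fin H) :
    ∀ᵐ x ∂(M.reward (σ h.castSucc) (π h (σ h.castSucc)) : Measure ℝ), x ∈ Set.Icc (0 : ℝ) 1 := by
  have h1 := hM.ae_rewards π hσ
  have hmp := measurePreserving_eval (fun h : Fin H =>
    (M.reward (σ h.castSucc) (π h (σ h.castSucc)) : Measure ℝ)) h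
  rw [← hmp.map_eq]
  refine (ae_map_iff hmp.measurable.aemeasurable measurableSet_Icc).2 ?_
  exact h1.mono fun ρ hρ => hρ.1 h

lemma ae_le_supReward {M : MDP S A H} {s : S} {a : A}
    (h : ∀ᵐ x ∂(M.reward s a : Measure ℝ), x ∈ Set.Icc (0 : ℝ) 1) :
    ∀ᵐ x ∂(M.reward s a : Measure ℝ), x ≤ M.supReward s a := by
  have := ae_le_essSup (f := (id : ℝ → ℝ)) (μ := (M.reward s a : Measure ℝ))
    ⟨1, by
      rw [Filter.eventually_map]
      exact h.mono fun x hx => hx.2⟩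
  exact this

lemma measure_Ioi_pos_of_lt_supReward {M : MDP S A H} {s : S} {a : A}
    (h : ∀ᵐ x ∂(M.reward s a : Measure ℝ), x ∈ Set.Icc (0 : ℝ) 1) {c : ℝ}
    (hc : c < M.supReward s a) : 0 < (M.reward s a : Measure ℝ) (Set.Ioi c) := by
  rw [pos_iff_ne_zero]
  intro h0
  refine absurd hc (not_lt.2 ?_)
  have hle : ∀ᵐ x ∂(M.reward s a : Measure ℝ), id x ≤ c := by
    rw [ae_iff]; simpa [Set.Ioi] using h0
  refine essSup_le_of_ae_le c hle ?_
  exact Filter.IsBoundedUnder.isCoboundedUnder_le ⟨0, by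
    rw [Filter.eventually_map]
    exact h.mono fun x hx => hx.1⟩

/-- As the rewards of a trajectory are independent given its states, they come simultaneously
close to their essential suprema with positive probability; so these sum up to at most `1` along
every path of positive probability. -/
lemma BoundedTotalReward.sum_supReward_le_one [Fintype S] [MeasurableSpace S]
    [DiscreteMeasurableSpace S] {M : MDP S A H} (hM : M.BoundedTotalReward) (π : Policy S A H)
    {σ : Fin (H + 1) → S} (hσ : M.stateSeqProb π σ ≠ 0) :
    ∑ h : Fin H, M.supReward (σ h.castSucc) (π h (σ h.castSucc)) ≤ 1 := by
  rcases Nat.eq_zero_or_pos H with rfl | hH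
  · simp
  refine le_of_forall_pos_le_add fun κ hκ => ?_
  have hH0 : (0 : ℝ) < H := by exact_mod_cast hH
  set B : Fin H → Set ℝ := fun h =>
    Set.Ioi (M.supReward (σ h.castSucc) (π h (σ h.castSucc)) - κ / H) with hB
  have hpos : Measure.pi (fun h : Fin H =>
      (M.reward (σ h.castSucc) (π h (σ h.castSucc)) : Measure ℝ)) (Set.univ.pi B) ≠ 0 := by
    rw [Measure.pi_pi]
    refine Finset.prod_ne_zero_iff.2 fun h _ => ne_of_gt ?_
    exact measure_Ioi_pos_of_lt_supReward (hM.ae_mem_Icc π hσ h)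
      (sub_lt_self _ (by positivity))
  obtain ⟨ρ, hρB, hρ⟩ := ((frequently_ae_mem_iff.2 hpos).and_eventually
    (hM.ae_rewards π hσ)).exists
  have : ∑ h : Fin H, (M.supReward (σ h.castSucc) (π h (σ h.castSucc)) - κ / H) ≤
      ∑ h : Fin H, ρ h := Finset.sum_le_sum fun h _ => (hρB h (Set.mem_univ _)).le
  rw [Finset.sum_sub_distrib, Finset.sum_const, Finset.card_univ, Fintype.card_fin,
    nsmul_eq_mul, mul_div_cancel₀ _ hH0.ne'] at this
  linarith [hρ.2]

end MDP

/-! ### Concentration of empirical means -/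

section Concentration

open ProbabilityTheory

variable {Ω : Type*} [MeasurableSpace Ω] {μ : Measure Ω} [IsProbabilityMeasure μ]

/-- The moment generating function of a `[0, 1]`-valued variable is bounded in terms of its mean
only, by convexity of the exponential. -/
lemma mgf_le_exp_of_mem_Icc {X : Ω → ℝ} (hX : Measurable X)
    (h01 : ∀ᵐ ω ∂μ, X ω ∈ Set.Icc (0 : ℝ) 1) {t : ℝ} (ht : |t| ≤ 1) :
    mgf X μ t ≤ Real.exp (μ[X] * (t + t ^ 2)) := by
  have hXint : Integrable X μ := Integrable.of_mem_Icc 0 1 hX.aemeasurable h01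
  have hm : 0 ≤ μ[X] := integral_nonneg_of_ae (h01.mono fun ω h => h.1)
  calc mgf X μ t ≤ ∫ ω, (1 + X ω * (Real.exp t - 1)) ∂μ := by
        refine integral_mono_ae (integrable_exp_mul_of_mem_Icc hX.aemeasurable h01)
          ((integrable_const 1).add (hXint.mul_const _)) (h01.mono fun ω h => ?_)
        have := convexOn_exp.2 (Set.mem_univ 0) (Set.mem_univ t) (sub_nonneg.2 h.2) h.1
          (sub_add_cancel 1 (X ω))
        simp only [smul_eq_mul, mul_zero, zero_add, Real.exp_zero, mul_one] at this
        change Real.exp (t * X ω) ≤ 1 + X ω * (Real.exp t - 1)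
        rw [mul_comm t]
        linarith
    _ = 1 + μ[X] * (Real.exp t - 1) := by
        rw [integral_add (integrable_const 1) (hXint.mul_const _), integral_mul_const]
        simp
    _ ≤ 1 + μ[X] * (t + t ^ 2) := by
        have := (abs_le.1 (Real.abs_exp_sub_one_sub_id_le ht)).2
        gcongr
        linarith
    _ ≤ Real.exp (μ[X] * (t + t ^ 2)) := by
        linarith [Real.add_one_le_exp (μ[X] * (t + t ^ 2))]

/-- The scale at which the Chernoff bound is applied: the optimal `√(L / M)`, capped at `1`. -/
lemma exists_chernoff_scale {M L : ℝ} (hL : 0 < L) :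
    ∃ l : ℝ, 0 < l ∧ l ≤ 1 ∧ M * l ^ 2 ≤ L ∧ 2 * L ≤ l * (2 * √(L * M) + 2 * L) := by
  rcases le_or_gt L M with h | h
  · have hM0 : 0 < M := hL.trans_le h
    have hs : 0 < √(L / M) := Real.sqrt_pos.2 (by positivity)
    refine ⟨√(L / M), hs, ?_, ?_, ?_⟩
    · exact Real.sqrt_le_one.2 ((div_le_one hM0).2 h)
    · rw [Real.sq_sqrt (by positivity), mul_div_cancel₀ _ hM0.ne']
    · have : √(L / M) * √(L * M) = L := by
        rw [← Real.sqrt_mul (by positivity), show L / M * (L * M) = L ^ 2 by field_simp,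
          Real.sqrt_sq hL.le]
      nlinarith
  · exact ⟨1, one_pos, le_rfl, by linarith, by linarith [Real.sqrt_nonneg (L * M)]⟩

/-- Chernoff's bound for the empirical mean of independent `[0, 1]`-valued variables, in the form
of a Bernstein-type confidence interval. -/
lemma measureReal_not_bernsteinClose_le {N : ℕ} (hN : 0 < N) {X : Fin N → Ω → ℝ}
    (hX : ∀ i, Measurable (X i)) (hind : iIndepFun X μ)
    (h01 : ∀ i, ∀ᵐ ω ∂μ, X i ω ∈ Set.Icc (0 : ℝ) 1) {m : ℝ} (hm : ∀ i, μ[X i] = m)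
    {L : ℝ} (hL : 0 < L) :
    μ.real {ω | ¬ BernsteinClose (L / N) ((∑ i, X i ω) / N) m} ≤ 2 * Real.exp (-L) := by
  have hN0 : (0 : ℝ) < N := by exact_mod_cast hN
  have hm0 : 0 ≤ m := by
    rw [← hm ⟨0, hN⟩]; exact integral_nonneg_of_ae ((h01 _).mono fun ω h => h.1)
  obtain ⟨l, hl0, hl1, hlM, hlL⟩ := exists_chernoff_scale (M := N * m) hL
  set t := 2 * √(L * (N * m)) + 2 * L with ht
  set Y : Ω → ℝ := ∑ i, X i with hY
  have hmgf : ∀ a : ℝ, |a| ≤ 1 → mgf Y μ a ≤ Real.exp (N * m * (a + a ^ 2)) := fun a ha => by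
    rw [hY, hind.mgf_sum hX]
    calc ∏ i, mgf (X i) μ a ≤ ∏ i : Fin N, Real.exp (m * (a + a ^ 2)) := by
          refine Finset.prod_le_prod (fun i _ => mgf_nonneg) fun i _ => ?_
          rw [← hm i]
          exact mgf_le_exp_of_mem_Icc (hX i) (h01 i) ha
      _ = _ := by
          rw [Finset.prod_const, Finset.card_univ, Fintype.card_fin, ← Real.exp_nat_mul]
          ring_nf
  have hint : ∀ a : ℝ, Integrable (fun ω => Real.exp (a * Y ω)) μ := fun a =>
    hind.integrable_exp_mul_sum hX fun i _ =>
      integrable_exp_mul_of_mem_Icc (hX i).aemeasurable (h01 i)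
  have hup : μ.real {ω | N * m + t ≤ Y ω} ≤ Real.exp (-L) := by
    refine (measure_ge_le_exp_mul_mgf _ hl0.le (hint l)).trans ?_
    refine (mul_le_mul_of_nonneg_left (hmgf l (by rwa [abs_of_pos hl0]))
      (Real.exp_nonneg _)).trans ?_
    rw [← Real.exp_add, Real.exp_le_exp]
    nlinarith
  have hlow : μ.real {ω | Y ω ≤ N * m - t} ≤ Real.exp (-L) := by
    refine (measure_le_le_exp_mul_mgf _ (neg_nonpos.2 hl0.le) (hint (-l))).trans ?_
    refine (mul_le_mul_of_nonneg_left (hmgf (-l) (by rwa [abs_neg, abs_of_pos hl0]))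
      (Real.exp_nonneg _)).trans ?_
    rw [← Real.exp_add, Real.exp_le_exp]
    nlinarith
  have hsub : {ω | ¬ BernsteinClose (L / N) ((∑ i, X i ω) / N) m} ⊆
      {ω | N * m + t ≤ Y ω} ∪ {ω | Y ω ≤ N * m - t} := by
    intro ω hω
    have hYω : Y ω = ∑ i, X i ω := by simp [hY]
    have hsq : N * √(L / N * m) = √(L * (N * m)) := by
      rw [show L * (N * m) = N ^ 2 * (L / N * m) by field_simp,
        Real.sqrt_mul (sq_nonneg (N : ℝ)), Real.sqrt_sq hN0.le]
    have htN : t = N * (2 * √(L / N * m) + 2 * (L / N)) := by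
      rw [ht, ← hsq]; field_simp
    have h1 : 2 * √(L / N * m) + 2 * (L / N) < |(∑ i, X i ω) / N - m| := not_le.1 hω
    have h2 : t < |Y ω - N * m| := by
      have : Y ω - N * m = N * ((∑ i, X i ω) / N - m) := by rw [hYω]; field_simp
      rw [this, abs_mul, abs_of_pos hN0, htN]
      exact mul_lt_mul_of_pos_left h1 hN0
    rcases lt_abs.1 h2 with h | h
    · left; show N * m + t ≤ Y ω; linarith
    · right; show Y ω ≤ N * m - t; linarith
  calc _ ≤ μ.real ({ω | N * m + t ≤ Y ω} ∪ {ω | Y ω ≤ N * m - t}) := measureReal_mono hsub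
    _ ≤ _ := measureReal_union_le _ _
    _ ≤ _ := by linarith

/-- Concentration of the empirical mean of a function of `N` equally distributed coordinates of a
product measure. -/
lemma pi_not_bernsteinClose_le {ι E : Type*} [Fintype ι] [MeasurableSpace E] (ν : ι → Measure E)
    [∀ i, IsProbabilityMeasure (ν i)] {N : ℕ} (hN : 0 < N) {e : Fin N → ι}
    (he : Function.Injective e) {ν₀ : Measure E} (hν : ∀ i, ν (e i) = ν₀) {g : E → ℝ}
    (hg : Measurable g) (h01 : ∀ᵐ x ∂ν₀, g x ∈ Set.Icc (0 : ℝ) 1) {L : ℝ} (hL : 0 < L) :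
    Measure.pi ν {ω | ¬ BernsteinClose (L / N) ((∑ i, g (ω (e i))) / N) (∫ x, g x ∂ν₀)} ≤
      ENNReal.ofReal (2 * Real.exp (-L)) := by
  have hind : iIndepFun (fun i (ω : ι → E) => g (ω i)) (Measure.pi ν) :=
    iIndepFun_pi (X := fun _ => g) fun i => hg.aemeasurable
  have h01' : ∀ i : Fin N, ∀ᵐ ω ∂Measure.pi ν, g (ω (e i)) ∈ Set.Icc (0 : ℝ) 1 := fun i => by
    have : ∀ᵐ x ∂ν (e i), g x ∈ Set.Icc (0 : ℝ) 1 := by rw [hν]; exact h01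
    exact Measure.tendsto_eval_ae_ae.eventually this
  have hmean : ∀ i : Fin N, ∫ ω, g (ω (e i)) ∂Measure.pi ν = ∫ x, g x ∂ν₀ := fun i => by
    rw [integral_comp_eval (μ := ν) (i := e i) hg.aestronglyMeasurable, hν]
  have hmeas : ∀ i : Fin N, Measurable fun ω : ι → E => g (ω (e i)) := fun i =>
    hg.comp (measurable_pi_apply _)
  rw [← ofReal_measureReal]
  exact ENNReal.ofReal_le_ofReal
    (measureReal_not_bernsteinClose_le hN hmeas (hind.precomp he) h01' hmean hL)

end Concentration

/-! ### The empirical model -/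

lemma toReal_empiricalPMF {X : Type*} [DecidableEq X] {N : ℕ} [NeZero N] (x : Fin N → X) (y : X) :
    (empiricalPMF x y).toReal = (∑ i, if x i = y then (1 : ℝ) else 0) / N := by
  have : ∀ i, (if y = x i then ((N : ℝ≥0∞))⁻¹ else 0) ≠ ∞ := fun i => by
    split_ifs
    · exact ENNReal.inv_ne_top.2 (by exact_mod_cast NeZero.ne N)
    · exact ENNReal.zero_ne_top
  rw [empiricalPMF, PMF.map_apply, tsum_fintype]
  simp only [PMF.uniformOfFintype_apply, Fintype.card_fin]
  rw [Finset.sum_div]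
  convert ENNReal.toReal_sum fun i _ => this i using 2 with i
  by_cases h : x i = y
  · simp [h]
  · simp [h, Ne.symm h]

namespace MDP

variable {S A : Type*} {H : ℕ}

/-- Rewards of this state-action pair are almost surely in `[0, 1]`. Under a bounded total reward
this holds for all pairs that some policy reaches; nothing is known about the others. -/
def RewardsInUnit (M : MDP S A H) (s : S) (a : A) : Prop :=
  ∀ᵐ x ∂(M.reward s a : Measure ℝ), x ∈ Set.Icc (0 : ℝ) 1

/-- The samples agree with `M` almost surely: no impossible transition, initial state or reward
has been drawn. -/
structure SampleConsistent (M : MDP S A H) {N : ℕ} (ω : GenSample S A N) : Prop where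
  trans : ∀ s a i, M.trans s a (ω.1 (s, a, i)).1 ≠ 0
  reward : ∀ s a i, M.RewardsInUnit s a →
    0 ≤ (ω.1 (s, a, i)).2 ∧ (ω.1 (s, a, i)).2 ≤ M.supReward s a
  init : ∀ i, M.init (ω.2 i) ≠ 0

/-- All parameters of the empirical model are Bernstein-close to those of `M`. -/
structure SampleAccurate (M : MDP S A H) {N : ℕ} [NeZero N] (τ : ℝ) (ω : GenSample S A N) :
    Prop where
  trans : ∀ s a s',
    BernsteinClose τ ((empiricalMDP H ω).trans s a s').toReal (M.trans s a s').toReal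
  reward : ∀ s a, M.RewardsInUnit s a →
    BernsteinClose τ ((empiricalMDP H ω).meanReward s a) (M.meanReward s a)
  init : ∀ s, BernsteinClose τ ((empiricalMDP H ω).init s).toReal (M.init s).toReal

lemma meanReward_empiricalMDP {N : ℕ} [NeZero N] (ω : GenSample S A N) (s : S) (a : A) :
    (empiricalMDP H ω).meanReward s a = (∑ i : Fin N, (ω.1 (s, a, i)).2) / (N : ℝ) := by
  show ∫ x, x ∂(Measure.dirac ((∑ i : Fin N, (ω.1 (s, a, i)).2) / (N : ℝ))) = _
  exact integral_dirac _ _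

lemma empiricalPMF_eq_zero {X : Type*} {N : ℕ} [NeZero N] {x : Fin N → X} {y : X}
    (h : ∀ i, x i ≠ y) : empiricalPMF x y = 0 := by
  rw [empiricalPMF, PMF.map_apply, ENNReal.tsum_eq_zero]
  exact fun i => if_neg (h i).symm

lemma integrable_reward {M : MDP S A H} {s : S} {a : A} (h : M.RewardsInUnit s a) :
    Integrable (fun x => x) (M.reward s a : Measure ℝ) :=
  Integrable.of_mem_Icc 0 1 aemeasurable_id h

section Perturbation

variable [Fintype S] [MeasurableSpace S] [DiscreteMeasurableSpace S]

lemma BoundedTotalReward.rewardsInUnit_of_isPath [Nonempty A] {M : MDP S A H}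
    (hM : M.BoundedTotalReward) (π : Policy S A H) {h : ℕ} (hh : h < H) {σ : ℕ → S}
    (hσ : IsPathUpTo M.initReal (M.kernel π) h σ) :
    M.RewardsInUnit (σ h) (extendPolicy π h (σ h)) := by
  obtain ⟨σ', hσ', heq⟩ := hσ.exists_extend (M.sum_kernel π) hh.le
  have := hM.ae_mem_Icc π (M.stateSeqProb_ne_zero_of_isPath π hσ') ⟨h, hh⟩
  simpa [RewardsInUnit, heq h le_rfl, extendPolicy, hh] using this

/-- On consistent and accurate samples the empirical model evaluates all policies correctly, up
to an error which depends on the horizon only through `H τ`. -/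
theorem abs_value_empirical_sub_value_le [Nonempty A] (hH : 0 < H) {M : MDP S A H}
    (hM : M.BoundedTotalReward) {N : ℕ} [NeZero N] {ω : GenSample S A N} {τ η : ℝ}
    (hcons : M.SampleConsistent ω) (hacc : M.SampleAccurate τ ω) (hτ : 0 ≤ τ) (hη : 0 < η)
    (hη4 : η ≤ 1 / 4) (hC : Fintype.card S * (H * τ * (1 / η + 2)) ≤ 1 / 4)
    (π : Policy S A H) :
    |(empiricalMDP H ω).value π - M.value π| ≤
      7 * η + 3 * (Fintype.card S * (H * τ * (1 / η + 2))) := by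
  have hN0 : (0 : ℝ) < N := by exact_mod_cast Nat.pos_of_ne_zero (NeZero.ne N)
  have hzero : ∀ (p : PMF S) (s : S), (p s).toReal = 0 → p s = 0 := fun p s h =>
    ((ENNReal.toReal_eq_zero_iff _).1 h).resolve_right (p.apply_ne_top s)
  rw [value_eq_sum_occ, value_eq_sum_occ]
  · refine abs_value_sub_value_le
      (u := fun h s => M.supReward s (extendPolicy π h s)) hH hτ hη hη4 hC
      (fun _ => ENNReal.toReal_nonneg) M.init.sum_toReal ?_ (M.kernel_nonneg π) (M.sum_kernel π)
      ((empiricalMDP H ω).kernel_nonneg π) ((empiricalMDP H ω).sum_kernel π) ?_ ?_ ?_ ?_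
      hacc.init (fun h s s' => hacc.trans _ _ _) ?_
    · intro s hs
      have : (empiricalMDP H ω).init s = 0 :=
        empiricalPMF_eq_zero fun i hi => hcons.init i (by rw [hi]; exact hzero _ _ hs)
      simp [initReal, this]
    · intro h s s' hs
      have : (empiricalMDP H ω).trans s (extendPolicy π h s) s' = 0 :=
        empiricalPMF_eq_zero fun i hi => hcons.trans s (extendPolicy π h s) i
          (by rw [hi]; exact hzero _ _ hs)
      simp [kernel, this]
    · intro h hh σ hσ
      have hu := hM.rewardsInUnit_of_isPath π hh hσ
      refine ⟨integral_nonneg_of_ae (hu.mono fun x hx => hx.1), ?_⟩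
      have := integral_mono_ae (integrable_reward hu) (integrable_const _) (ae_le_supReward hu)
      simpa [meanReward] using this
    · intro h hh σ hσ
      have hu := hM.rewardsInUnit_of_isPath π hh hσ
      have hr := fun i => hcons.reward (σ h) (extendPolicy π h (σ h)) i hu
      rw [meanReward_empiricalMDP]
      refine ⟨div_nonneg (Finset.sum_nonneg fun i _ => (hr i).1) hN0.le, ?_⟩
      rw [div_le_iff₀ hN0]
      refine (Finset.sum_le_sum fun i _ => (hr i).2).trans_eq ?_
      simp [mul_comm]
    · intro σ hσ
      have := hM.sum_supReward_le_one π (M.stateSeqProb_ne_zero_of_isPath π hσ)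
      rw [Finset.sum_range]
      simpa using this
    · intro h hh σ hσ
      exact hacc.reward _ _ (hM.rewardsInUnit_of_isPath π hh hσ)
  · intro σ hσ h
    exact integrable_reward (hM.ae_mem_Icc π hσ h)
  · intro σ hσ h
    exact integrable_dirac (by simp)

end Perturbation

/-! ### The probability of a bad sample -/

lemma _root_.PMF.ae_ne_zero {X : Type*} [MeasurableSpace X] [DiscreteMeasurableSpace X]
    (p : PMF X) : ∀ᵐ x ∂p.toMeasure, p x ≠ 0 := by
  rw [ae_iff, PMF.toMeasure_apply_eq_zero_iff _ (MeasurableSet.of_discrete), Set.disjoint_left]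
  exact fun x hx hx' => (p.mem_support_iff x).1 hx (not_not.1 hx')

lemma genLaw_reward_not_close_le [Fintype S] [Fintype A] [MeasurableSpace S]
    (M : MDP S A H) {N : ℕ} [NeZero N] {L : ℝ} (hL : 0 < L) {s : S} {a : A}
    (hu : M.RewardsInUnit s a) :
    M.genLaw N {ω | ¬ BernsteinClose (L / N) ((empiricalMDP H ω).meanReward s a)
      (M.meanReward s a)} ≤ ENNReal.ofReal (2 * Real.exp (-L)) := by
  set ν := fun i : S × A × Fin N =>
    (M.trans i.1 i.2.1).toMeasure.prod (M.reward i.1 i.2.1 : Measure ℝ) with hν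
  have hmean : ∫ x : S × ℝ, x.2 ∂((M.trans s a).toMeasure.prod (M.reward s a : Measure ℝ)) =
      M.meanReward s a := by
    simpa [meanReward] using integral_fun_snd (μ := (M.trans s a).toMeasure)
      (ν := (M.reward s a : Measure ℝ)) fun x : ℝ => x
  have hpi := pi_not_bernsteinClose_le ν (Nat.pos_of_ne_zero (NeZero.ne N))
    (e := fun i : Fin N => (s, a, i)) (fun i j hij => by simpa using hij)
    (ν₀ := (M.trans s a).toMeasure.prod (M.reward s a : Measure ℝ)) (fun i => rfl)
    (g := fun x : S × ℝ => x.2) measurable_snd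
    (Measure.quasiMeasurePreserving_snd.ae hu) hL
  refine le_trans (le_of_eq ?_) ((measurePreserving_fst (μ := Measure.pi ν)
    (ν := Measure.pi fun _ : Fin N => M.init.toMeasure)).measure_preimage_le _ |>.trans hpi)
  congr 1
  ext ω
  show ¬ BernsteinClose _ _ _ ↔ ¬ BernsteinClose _ _ _
  rw [meanReward_empiricalMDP, ← hmean]

variable [Fintype S] [MeasurableSpace S] [DiscreteMeasurableSpace S]
  [Fintype A]

instance (M : MDP S A H) (N : ℕ) : IsProbabilityMeasure (M.genLaw N) := by
  unfold genLaw; infer_instance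

lemma ae_sampleConsistent (M : MDP S A H) (N : ℕ) :
    ∀ᵐ ω ∂(M.genLaw N), M.SampleConsistent ω := by
  have hfst : ∀ᵐ ω ∂(M.genLaw N), ∀ i : S × A × Fin N,
      M.trans i.1 i.2.1 (ω.1 i).1 ≠ 0 ∧ (M.RewardsInUnit i.1 i.2.1 →
        0 ≤ (ω.1 i).2 ∧ (ω.1 i).2 ≤ M.supReward i.1 i.2.1) := by
    refine Measure.quasiMeasurePreserving_fst.ae (p := fun x : S × A × Fin N → S × ℝ =>
      ∀ i : S × A × Fin N, M.trans i.1 i.2.1 (x i).1 ≠ 0 ∧ (M.RewardsInUnit i.1 i.2.1 →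
        0 ≤ (x i).2 ∧ (x i).2 ≤ M.supReward i.1 i.2.1)) (ae_all_iff.2 fun i => ?_)
    refine (Measure.tendsto_eval_ae_ae (i := i)).eventually
      (p := fun x : S × ℝ => M.trans i.1 i.2.1 x.1 ≠ 0 ∧ (M.RewardsInUnit i.1 i.2.1 →
        0 ≤ x.2 ∧ x.2 ≤ M.supReward i.1 i.2.1)) ?_
    refine (Measure.quasiMeasurePreserving_fst.ae (PMF.ae_ne_zero _)).and ?_
    by_cases hu : M.RewardsInUnit i.1 i.2.1
    · have h1 : ∀ᵐ x ∂(M.reward i.1 i.2.1 : Measure ℝ), 0 ≤ x ∧ x ≤ M.supReward i.1 i.2.1 :=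
        hu.mp ((ae_le_supReward hu).mono fun x hx hx' => ⟨hx'.1, hx⟩)
      exact (Measure.quasiMeasurePreserving_snd.ae h1).mono fun x hx _ => hx
    · exact Filter.Eventually.of_forall fun x hx => absurd hx hu
  have hsnd : ∀ᵐ ω ∂(M.genLaw N), ∀ i, M.init (ω.2 i) ≠ 0 := by
    refine Measure.quasiMeasurePreserving_snd.ae
      (p := fun x : Fin N → S => ∀ i, M.init (x i) ≠ 0) (ae_all_iff.2 fun i => ?_)
    exact (Measure.tendsto_eval_ae_ae (i := i)).eventually (p := fun x : S => M.init x ≠ 0)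
      (PMF.ae_ne_zero _)
  filter_upwards [hfst, hsnd] with ω h1 h2
  exact ⟨fun s a i => (h1 (s, a, i)).1, fun s a i => (h1 (s, a, i)).2, h2⟩

lemma integral_ite_toMeasure [DecidableEq S] (p : PMF S) (s : S) :
    ∫ x, (if x = s then (1 : ℝ) else 0) ∂p.toMeasure = (p s).toReal := by
  rw [PMF.integral_eq_sum]
  simp

lemma ite_mem_Icc (p : Prop) [Decidable p] : (if p then (1 : ℝ) else 0) ∈ Set.Icc (0 : ℝ) 1 := by
  split_ifs <;> simp

lemma genLaw_trans_not_close_le (M : MDP S A H) {N : ℕ} [NeZero N] {L : ℝ} (hL : 0 < L)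
    (s : S) (a : A) (s' : S) :
    M.genLaw N {ω | ¬ BernsteinClose (L / N) ((empiricalMDP H ω).trans s a s').toReal
      (M.trans s a s').toReal} ≤ ENNReal.ofReal (2 * Real.exp (-L)) := by
  classical
  set ν := fun i : S × A × Fin N =>
    (M.trans i.1 i.2.1).toMeasure.prod (M.reward i.1 i.2.1 : Measure ℝ) with hν
  set g : S × ℝ → ℝ := fun x => if x.1 = s' then 1 else 0 with hgdef
  have hg : Measurable g := (measurable_of_finite (fun x : S => if x = s' then (1 : ℝ) else 0)).comp
    measurable_fst
  have hmean : ∫ x, g x ∂((M.trans s a).toMeasure.prod (M.reward s a : Measure ℝ)) =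
      (M.trans s a s').toReal := by
    rw [← integral_ite_toMeasure]
    simpa using integral_fun_fst (μ := (M.trans s a).toMeasure)
      (ν := (M.reward s a : Measure ℝ)) fun x : S => if x = s' then (1 : ℝ) else 0
  have hpi := pi_not_bernsteinClose_le ν (Nat.pos_of_ne_zero (NeZero.ne N))
    (e := fun i : Fin N => (s, a, i)) (fun i j hij => by simpa using hij)
    (ν₀ := (M.trans s a).toMeasure.prod (M.reward s a : Measure ℝ)) (fun i => rfl) hg
    (Filter.Eventually.of_forall fun x => ite_mem_Icc _) hL
  refine le_trans (le_of_eq ?_) ((measurePreserving_fst (μ := Measure.pi ν)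
    (ν := Measure.pi fun _ : Fin N => M.init.toMeasure)).measure_preimage_le _ |>.trans hpi)
  congr 1
  ext ω
  show ¬ BernsteinClose _ (empiricalPMF _ s').toReal _ ↔ ¬ BernsteinClose _ _ _
  rw [toReal_empiricalPMF, ← hmean]

lemma genLaw_init_not_close_le (M : MDP S A H) {N : ℕ} [NeZero N] {L : ℝ} (hL : 0 < L)
    (s : S) :
    M.genLaw N {ω | ¬ BernsteinClose (L / N) ((empiricalMDP H ω).init s).toReal
      (M.init s).toReal} ≤ ENNReal.ofReal (2 * Real.exp (-L)) := by
  classical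
  have hpi := pi_not_bernsteinClose_le (fun _ : Fin N => M.init.toMeasure)
    (Nat.pos_of_ne_zero (NeZero.ne N)) (e := id) Function.injective_id (fun i => rfl)
    (g := fun x => if x = s then 1 else 0) (measurable_of_finite _)
    (Filter.Eventually.of_forall fun x => ite_mem_Icc _) hL
  rw [integral_ite_toMeasure] at hpi
  refine le_trans (le_of_eq ?_) ((measurePreserving_snd (ν := Measure.pi fun _ => M.init.toMeasure)
    (μ := Measure.pi fun i : S × A × Fin N =>
      (M.trans i.1 i.2.1).toMeasure.prod (M.reward i.1 i.2.1 : Measure ℝ))).measure_preimage_le _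
      |>.trans hpi)
  congr 1
  ext ω
  show ¬ BernsteinClose _ (empiricalPMF _ s).toReal _ ↔ ¬ BernsteinClose _ _ _
  rw [toReal_empiricalPMF]
  rfl

/-- Union bound over all parameters of the model. -/
lemma genLaw_not_sampleAccurate_le (M : MDP S A H) {N : ℕ} [NeZero N] {L : ℝ} (hL : 0 < L) :
    M.genLaw N {ω | ¬ M.SampleAccurate (L / N) ω} ≤
      ENNReal.ofReal ((Fintype.card S * Fintype.card A * Fintype.card S +
        Fintype.card S * Fintype.card A + Fintype.card S) * (2 * Real.exp (-L))) := by
  classical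
  set B := ENNReal.ofReal (2 * Real.exp (-L)) with hB
  set E₁ : Set (GenSample S A N) := ⋃ i : S × A × S, {ω | ¬ BernsteinClose (L / N)
    ((empiricalMDP H ω).trans i.1 i.2.1 i.2.2).toReal (M.trans i.1 i.2.1 i.2.2).toReal}
  set E₂ : Set (GenSample S A N) := ⋃ i : S × A, {ω | M.RewardsInUnit i.1 i.2 ∧
    ¬ BernsteinClose (L / N) ((empiricalMDP H ω).meanReward i.1 i.2) (M.meanReward i.1 i.2)}
  set E₃ : Set (GenSample S A N) := ⋃ s : S, {ω | ¬ BernsteinClose (L / N)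
    ((empiricalMDP H ω).init s).toReal (M.init s).toReal}
  have hsub : {ω | ¬ M.SampleAccurate (L / N) ω} ⊆ E₁ ∪ E₂ ∪ E₃ := by
    intro ω hω
    by_contra hcon
    simp only [E₁, E₂, E₃, Set.mem_union, Set.mem_iUnion, Set.mem_ofPred_eq, not_or, not_exists,
      not_and, not_not] at hcon
    exact hω ⟨fun s a s' => hcon.1.1 (s, a, s'), fun s a => hcon.1.2 (s, a), hcon.2⟩
  have h1 : M.genLaw N E₁ ≤ Fintype.card (S × A × S) * B := by
    refine (measure_iUnion_fintype_le _ _).trans ((Finset.sum_le_sum fun i _ =>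
      M.genLaw_trans_not_close_le hL i.1 i.2.1 i.2.2).trans_eq ?_)
    rw [Finset.sum_const, nsmul_eq_mul, Finset.card_univ]
  have h2 : M.genLaw N E₂ ≤ Fintype.card (S × A) * B := by
    refine (measure_iUnion_fintype_le _ _).trans ((Finset.sum_le_sum (g := fun _ => B)
      fun i _ => ?_).trans_eq ?_)
    · by_cases hu : M.RewardsInUnit i.1 i.2
      · exact (measure_mono fun ω hω => hω.2).trans (M.genLaw_reward_not_close_le hL hu)
      · simp [hu]
    rw [Finset.sum_const, nsmul_eq_mul, Finset.card_univ]
  have h3 : M.genLaw N E₃ ≤ Fintype.card S * B := by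
    refine (measure_iUnion_fintype_le _ _).trans ((Finset.sum_le_sum fun i _ =>
      M.genLaw_init_not_close_le hL i).trans_eq ?_)
    rw [Finset.sum_const, nsmul_eq_mul, Finset.card_univ]
  calc _ ≤ M.genLaw N (E₁ ∪ E₂ ∪ E₃) := measure_mono hsub
    _ ≤ M.genLaw N E₁ + M.genLaw N E₂ + M.genLaw N E₃ :=
      (measure_union_le _ _).trans (add_le_add_left (measure_union_le _ _) _)
    _ ≤ Fintype.card (S × A × S) * B + Fintype.card (S × A) * B + Fintype.card S * B := by gcongr
    _ = _ := by
      rw [ENNReal.ofReal_mul (by positivity), ← hB, ← add_mul, ← add_mul]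
      congr 1
      simp only [Fintype.card_prod]
      norm_cast
      rw [mul_assoc]

end MDP

end

/-! ### Sample complexity -/

/-- With `L = 7 n log (2 / δ)`, the failure probabilities `2 exp (-L)` of at most `3 n` events add
up to at most `δ`. -/
lemma three_mul_two_mul_exp_neg_le {n δ : ℝ} (hn : 1 ≤ n) (hδ0 : 0 < δ) (hδ1 : δ < 1) :
    3 * n * (2 * Real.exp (-(7 * n * Real.log (2 / δ)))) ≤ δ := by
  set l := Real.log (2 / δ) with hl
  have hexp : Real.exp l = 2 / δ := Real.exp_log (by positivity)
  have hl2 : 1 / 2 ≤ l := by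
    have h1 : Real.log 2 ≤ l := Real.log_le_log two_pos (by rw [le_div_iff₀ hδ0]; linarith)
    linarith [Real.log_two_gt_d9]
  have h1 : 3 * n ≤ Real.exp (6 * n * l) := by
    nlinarith [Real.add_one_le_exp (6 * n * l)]
  have h2 : Real.exp (-(7 * n * l)) ≤ Real.exp (-(6 * n * l)) * Real.exp (-l) := by
    rw [← Real.exp_add, Real.exp_le_exp]; nlinarith
  have h3 : Real.exp (-l) = δ / 2 := by rw [Real.exp_neg, hexp, inv_div]
  have h4 : 3 * n * Real.exp (-(6 * n * l)) ≤ 1 := by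
    rw [Real.exp_neg, ← div_eq_mul_inv, div_le_one (Real.exp_pos _)]
    exact h1
  calc 3 * n * (2 * Real.exp (-(7 * n * l)))
      ≤ 3 * n * (2 * (Real.exp (-(6 * n * l)) * Real.exp (-l))) := by gcongr
    _ = (3 * n * Real.exp (-(6 * n * l))) * δ := by rw [h3]; ring
    _ ≤ 1 * δ := by gcongr
    _ = δ := one_mul δ

/-- The batches consist of `H` queries and there are `H K` queries per state-action pair, so their
number is an integer without rounding. -/
lemma numBatches_mul (S A : Type*) [Fintype S] [Fintype A] {H : ℕ} (hH : 0 < H) (K : ℕ) :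
    numBatches S A H (H * K) = (Fintype.card S * Fintype.card A + 1) * K := by
  have hH0 : (H : ℝ) ≠ 0 := by exact_mod_cast hH.ne'
  have : (numQueries S A (H * K) : ℝ) / H =
      (((Fintype.card S * Fintype.card A + 1) * K : ℕ) : ℝ) := by
    simp only [numQueries, Fintype.card_prod, Fintype.card_fin]
    push_cast
    field_simp
  rw [numBatches, this, Nat.ceil_natCast]

namespace MDP

variable {S A : Type*} [Fintype S] [MeasurableSpace S] {H : ℕ}

/-- Policies that are optimal for a uniformly accurate model lose at most twice its accuracy. -/
lemma optValue_sub_le_of_isOptimal [Nonempty A] {M M' : MDP S A H} {ε : ℝ}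
    (hclose : ∀ π, |M'.value π - M.value π| ≤ ε / 2) {π : Policy S A H} (hπ : M'.IsOptimal π) :
    M.optValue - ε ≤ M.value π := by
  rw [sub_le_iff_le_add]
  refine ciSup_le fun π' => ?_
  have h1 := abs_le.1 (hclose π)
  have h2 := abs_le.1 (hclose π')
  linarith [hπ π', h1.2, h2.1]

lemma exists_isOptimal [Finite A] [Nonempty A] (M : MDP S A H) :
    ∃ π : Policy S A H, M.IsOptimal π :=
  Finite.exists_max M.value

end MDP

theorem mainTheorem3 {S A : Type*} [Fintype S] [Fintype A] [Nonempty A]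
    [MeasurableSpace S] [DiscreteMeasurableSpace S] {H : ℕ} (hH : 0 < H)
    (M : MDP S A H) (hM : M.BoundedTotalReward)
    (ε δ : ℝ) (hε0 : 0 < ε) (hε1 : ε ≤ 1) (hδ0 : 0 < δ) (hδ1 : δ < 1) :
    ∃ N : ℕ+,
      (N : ℕ) = H * ⌊2 ^ 29 * (Fintype.card S : ℝ) ^ 5 * (Fintype.card A : ℝ) ^ 3 *
        Real.log (2 / δ) / ε ^ 3⌋₊ ∧
      (numBatches S A H N : ℝ) ≤ 2 ^ 30 * (Fintype.card S : ℝ) ^ 6 * (Fintype.card A : ℝ) ^ 4 *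
        Real.log (2 / δ) / ε ^ 3 ∧
      ENNReal.ofReal (1 - δ) ≤ M.genLaw N
        {ω | (∃ π : Policy S A H, (empiricalMDP H ω).IsOptimal π) ∧
          ∀ π : Policy S A H, (empiricalMDP H ω).IsOptimal π → M.optValue - ε ≤ M.value π} := by
  have hSne : Nonempty S := ⟨M.init.support_nonempty.some⟩
  set s : ℝ := (Fintype.card S : ℝ) with hs
  set a : ℝ := (Fintype.card A : ℝ) with ha
  set l := Real.log (2 / δ) with hl
  set x := 2 ^ 29 * s ^ 5 * a ^ 3 * l / ε ^ 3 with hx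
  set K := ⌊x⌋₊ with hK
  have hs1 : 1 ≤ s := by rw [hs]; exact_mod_cast Fintype.card_pos
  have ha1 : 1 ≤ a := by rw [ha]; exact_mod_cast Fintype.card_pos
  have hl2 : 1 / 2 ≤ l := by
    have h1 : Real.log 2 ≤ l := Real.log_le_log two_pos (by rw [le_div_iff₀ hδ0]; linarith)
    linarith [Real.log_two_gt_d9]
  have hxε : 2 ^ 29 * (s ^ 3 * a * l) / ε ^ 2 ≤ x := by
    have h1 : s ^ 3 * a ≤ s ^ 5 * a ^ 3 := by
      have := pow_le_pow_right₀ hs1 (show 3 ≤ 5 by norm_num)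
      have := pow_le_pow_right₀ ha1 (show 1 ≤ 3 by norm_num)
      rw [pow_one] at this
      gcongr
    have h2 : ε ^ 3 ≤ ε ^ 2 := pow_le_pow_of_le_one hε0.le hε1 (by norm_num)
    calc 2 ^ 29 * (s ^ 3 * a * l) / ε ^ 2 ≤ 2 ^ 29 * (s ^ 5 * a ^ 3 * l) / ε ^ 2 := by gcongr
      _ ≤ 2 ^ 29 * (s ^ 5 * a ^ 3 * l) / ε ^ 3 := by gcongr
      _ = x := by rw [hx]; ring
  have hsal : 1 / 2 ≤ s ^ 3 * a * l := by
    have : 1 ≤ s ^ 3 * a := one_le_mul_of_one_le_of_one_le (one_le_pow₀ hs1) ha1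
    nlinarith
  have hx2 : 2 ≤ x := by
    refine le_trans ?_ hxε
    rw [le_div_iff₀ (by positivity)]
    have : ε ^ 2 ≤ 1 := pow_le_one₀ hε0.le hε1
    linarith
  have hKx : x / 2 ≤ K := by
    have := Nat.lt_floor_add_one x
    rw [← hK] at this
    linarith
  have hK0 : 0 < (K : ℝ) := by linarith
  have hKpos : 0 < K := by exact_mod_cast hK0
  have hH0 : 0 < (H : ℝ) := by exact_mod_cast hH
  have hN : 0 < H * K := Nat.mul_pos hH hKpos
  refine ⟨⟨H * K, hN⟩, rfl, ?_, ?_⟩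
  · rw [PNat.mk_coe, numBatches_mul S A hH]
    push_cast
    rw [← hs, ← ha]
    have h1 : (K : ℝ) ≤ x := Nat.floor_le (by linarith)
    have h2 : s * a + 1 ≤ 2 * (s * a) := by
      have := one_le_mul_of_one_le_of_one_le hs1 ha1
      linarith
    calc (s * a + 1) * K ≤ 2 * (s * a) * x := by gcongr
      _ = _ := by rw [hx]; ring
  · have : NeZero (H * K) := ⟨hN.ne'⟩
    have hn1 : 1 ≤ s ^ 2 * a := one_le_mul_of_one_le_of_one_le (one_le_pow₀ hs1) ha1
    set L := 7 * (s ^ 2 * a) * l with hL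
    have hL0 : 0 < L := by positivity
    have hτ : 0 ≤ L / ((H * K : ℕ) : ℝ) := by positivity
    -- `hC` is used with `η = ε / 28`, so that `7 η + 3 C ≤ ε / 4 + ε / 4`
    have hC : s * (H * (L / ((H * K : ℕ) : ℝ)) * (1 / (ε / 28) + 2)) ≤ ε / 12 := by
      have e1 : s * (H * (L / ((H * K : ℕ) : ℝ)) * (1 / (ε / 28) + 2)) =
          7 * (s ^ 3 * a * l) * (28 + 2 * ε) / (ε * K) := by
        push_cast
        rw [hL]
        field_simp
      rw [e1, div_le_iff₀ (by positivity)]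
      have h1 : 2 ^ 28 * (s ^ 3 * a * l) ≤ ε ^ 2 * K := by
        have h2 := hxε.trans (show x ≤ 2 * K by linarith)
        rw [div_le_iff₀ (by positivity)] at h2
        linarith
      have h3 : 7 * (s ^ 3 * a * l) * (28 + 2 * ε) ≤ 7 * (s ^ 3 * a * l) * 30 := by
        gcongr
        linarith
      calc _ ≤ 7 * (s ^ 3 * a * l) * 30 := h3
        _ ≤ 2 ^ 28 * (s ^ 3 * a * l) / 12 := by linarith
        _ ≤ ε ^ 2 * K / 12 := by gcongr
        _ = _ := by ring
    have hgood : ∀ ω : GenSample S A (H * K), M.SampleConsistent ω →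
        M.SampleAccurate (L / ((H * K : ℕ) : ℝ)) ω →
        (∃ π : Policy S A H, (empiricalMDP H ω).IsOptimal π) ∧
          ∀ π : Policy S A H, (empiricalMDP H ω).IsOptimal π →
            M.optValue - ε ≤ M.value π := by
      intro ω hcons hacc
      refine ⟨MDP.exists_isOptimal _, fun π hπ =>
        MDP.optValue_sub_le_of_isOptimal (fun π' => ?_) hπ⟩
      refine (MDP.abs_value_empirical_sub_value_le hH hM hcons hacc hτ
        (show 0 < ε / 28 by positivity) (by linarith) (hC.trans (by linarith)) π').trans ?_
      linarith
    have hbad : M.genLaw (H * K) {ω | ¬ M.SampleAccurate (L / ((H * K : ℕ) : ℝ)) ω} ≤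
        ENNReal.ofReal δ := by
      refine (M.genLaw_not_sampleAccurate_le hL0).trans (ENNReal.ofReal_le_ofReal ?_)
      refine le_trans ?_ (three_mul_two_mul_exp_neg_le hn1 hδ0 hδ1)
      rw [← hs, ← ha]
      have h1 : s * a ≤ s ^ 2 * a := by
        gcongr
        exact le_self_pow₀ hs1 two_ne_zero
      have h2 : s ≤ s * a := le_mul_of_one_le_right (by linarith) ha1
      refine mul_le_mul_of_nonneg_right ?_ (by positivity)
      linarith [show s * a * s = s ^ 2 * a by ring]
    set G : Set (GenSample S A (H * K)) :=
      {ω | (∃ π : Policy S A H, (empiricalMDP H ω).IsOptimal π) ∧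
        ∀ π : Policy S A H, (empiricalMDP H ω).IsOptimal π → M.optValue - ε ≤ M.value π}
    have hGc : M.genLaw (H * K) Gᶜ ≤ ENNReal.ofReal δ := by
      refine le_trans (measure_mono_ae ?_) hbad
      filter_upwards [M.ae_sampleConsistent (H * K)] with ω hω hωG hacc
      exact hωG (hgood ω hω hacc)
    -- `G` need not be known to be measurable: subadditivity suffices
    have h1 : 1 ≤ M.genLaw (H * K) G + M.genLaw (H * K) Gᶜ := by
      rw [← measure_univ (μ := M.genLaw (H * K)), ← Set.union_compl_self G]
      exact measure_union_le _ _
    rw [ENNReal.ofReal_sub _ hδ0.le, ENNReal.ofReal_one, tsub_le_iff_right]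
    exact h1.trans (add_le_add le_rfl hGc)
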